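/- Let $M$ be a smooth (Hausdorff, second countable, boundaryless) manifold of dimension $d\ge 1$. A hybrid dynamical system $\mathcal{H}=(M,S,X,\Delta)$ consists of an embedded smooth submanifold $S\subset M$ of codimension $1$, a smooth vector field $X$ on $M$ and a smooth map $\Delta\colon S\to M$ such that $S\cap\Delta(S)=\emptyset$ and $\overline{S}\cap\overline{\Delta(S)}$ has codimension at least $2$. Its hybrid flow $\varphi^{\mathcal H}_t$, $t\ge 0$, follows the flow of $X$ until it meets $S$, is then reset by $\Delta$, and continues in the same way (with finitely many impacts up to time $t$; it need not be defined everywhere). The system is called smooth if (A.1) whenever $\varphi^{\mathcal H}_t(x)\in\overline{S}\setminus S$, there is $\varepsilon>0$ with $\varphi^{\mathcal H}_{t+\delta}(x)$ defined and not in $S$ for all $0<\delta<\varepsilon$, and (A.2) $T_xM=T_xS\oplus\mathbb{R}X(x)$ for all $x\in S$. A differential form $\alpha$ on $M$ is called hybrid-invariant if $(\varphi^{\mathcal H}_t)^*\alpha=\alpha$ for all $t\ge 0$, on every open set disjoint from $S$ on which $\varphi^{\mathcal H}_t$ is defined and smooth. For a volume form $\mu$ on $M$ (a smooth nowhere vanishing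 $d$-form), let $\mathrm{div}_\mu(X)$ be the function with $\mathcal{L}_X\mu=\mathrm{div}_\mu(X)\,\mu$, and let the hybrid Jacobian $\mathcal{J}_\mu(\Delta)\colon S\to\mathbb{R}$ be the unique function with $\Delta^*(i_X\mu)=\mathcal{J}_\mu(\Delta)\cdot\iota_S^*(i_X\mu)$, where $\iota_S\colon S\hookrightarrow M$ is the inclusion and $\Delta$ is viewed as a map $S\to M$. **Proposition.** Let $\mathcal{H}=(M,S,X,\Delta)$ be a smooth hybrid system and let $\mu$ be a volume form on $M$. Suppose that $g\in C^\infty(M)$ solves the hybrid cohomology equation $$dg(X)=-\mathrm{div}_\mu(X)\ \text{ on } M,\qquad g\circ\Delta-g|_S=-\ln\left(\mathcal{J}_\mu(\Delta)\right)\ \text{ on } S,$$ where the second equation includes that $\mathcal{J}_\mu(\Delta)>0$ on $S$. Then $e^{g}\mu$ is a smooth hybrid-invariant volume form. More generally, $c\,e^{g}\mu$ is a smooth hybrid-invariant volume form for every constant $c\neq 0$. -/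

import Mathlib

open scoped Manifold ContDiff Topology

noncomputable section

namespace HybridDyn

/-- The model space `ℝⁿ` with its Euclidean norm. -/
abbrev Eucl (n : ℕ) : Type := EuclideanSpace ℝ (Fin n)

/-- Differential `k`-forms (no regularity imposed) on an `n`-manifold. -/
abbrev DiffForm (n k : ℕ) (M : Type*) [TopologicalSpace M] [ChartedSpace (Eucl n) M] : Type _ :=
  ∀ x : M, TangentSpace (𝓡 n) x [⋀^Fin k]→L[ℝ] ℝ

section Forms

variable {m n k : ℕ}
  {N : Type*} [TopologicalSpace N] [ChartedSpace (Eucl m) N]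
  {M : Type*} [TopologicalSpace M] [ChartedSpace (Eucl n) M]

/-- The pullback `f^* α`, i.e. `(f^* α)_x (v₁, …) = α_{f x} (Df_x v₁, …)`. -/
def pullback (f : N → M) (α : DiffForm n k M) : DiffForm m k N :=
  fun x => (α (f x)).compContinuousLinearMap (mfderiv (𝓡 m) (𝓡 n) f x)

/-- The interior product `i_X α = α(X, ⬝, …, ⬝)`. -/
def interior (X : ∀ x : M, TangentSpace (𝓡 n) x) (α : DiffForm n (k + 1) M) : DiffForm n k M :=
  fun x => ContinuousAlternatingMap.curryLeft (E := Eucl n) (α x) (X x)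

/-- The coordinate expression of the form `α` in the preferred chart at `x₀`. -/
def formInChart (α : DiffForm n k M) (x₀ : M) : Eucl n → Eucl n [⋀^Fin k]→L[ℝ] ℝ :=
  pullback (extChartAt (𝓡 n) x₀).symm α

/-- The coordinate expression of the vector field `X` in the preferred chart at `x₀`. -/
def fieldInChart (X : ∀ x : M, TangentSpace (𝓡 n) x) (x₀ : M) : Eucl n → Eucl n :=
  VectorField.mpullback 𝓘(ℝ, Eucl n) (𝓡 n) (extChartAt (𝓡 n) x₀).symm X

/-- `α` is a smooth differential form: all its coordinate expressions are smooth. -/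
def IsSmoothForm (α : DiffForm n k M) : Prop :=
  ∀ x₀ : M, ContDiffOn ℝ ∞ (formInChart α x₀) (extChartAt (𝓡 n) x₀).target

/-- A volume form: a smooth nowhere vanishing form of top degree. -/
structure IsVolumeForm (μ : DiffForm n n M) : Prop where
  smooth : IsSmoothForm μ
  ne_zero : ∀ x, μ x ≠ 0

/-- The Lie derivative `L_X α = d (i_X α) + i_X (d α)`, computed at `x` in the preferred chart
at `x`. -/
def lieDerivative (X : ∀ x : M, TangentSpace (𝓡 n) x) (α : DiffForm n (k + 1) M) :
    DiffForm n (k + 1) M :=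
  fun x =>
    let a := formInChart α x
    let Y := fieldInChart X x
    let y : Eucl n := extChartAt (𝓡 n) x x
    ContinuousAlternatingMap.compContinuousLinearMap
      (extDeriv (fun z => (a z).curryLeft (Y z)) y + (extDeriv a y).curryLeft (Y y))
      (mfderiv (𝓡 n) 𝓘(ℝ, Eucl n) (extChartAt (𝓡 n) x) x)

/-- The standard frame of the tangent space at `x` (the coordinate frame of the preferred chart
at `x`). -/
def frame (x : M) : Module.Basis (Fin n) ℝ (TangentSpace (𝓡 n) x) :=
  (EuclideanSpace.basisFun (Fin n) ℝ).toBasis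

/-- Two top-degree covectors, the second one nonzero, differ by the quotient of their values on
the standard frame. -/
theorem eq_ratio_smul (x : M) (α β : TangentSpace (𝓡 n) x [⋀^Fin n]→L[ℝ] ℝ) (hβ : β ≠ 0) :
    α = (α (frame x) / β (frame x)) • β := by
  have key : ∀ γ δ : TangentSpace (𝓡 n) x [⋀^Fin n]→L[ℝ] ℝ,
      γ (frame x) = δ (frame x) → γ = δ := by
    intro γ δ h
    apply ContinuousAlternatingMap.toAlternatingMap_injective
    rw [γ.toAlternatingMap.eq_smul_basis_det (frame x),
      δ.toAlternatingMap.eq_smul_basis_det (frame x)]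
    exact congrArg (· • (frame x).det) h
  have hb : β (frame x) ≠ 0 := fun h => hβ (key β 0 h)
  apply key
  simp [hb]

end Forms

section Divergence

variable {n : ℕ} {M : Type*} [TopologicalSpace M] [ChartedSpace (Eucl (n + 1)) M]

/-- The divergence of `X` with respect to the volume form `μ`: the function with
`L_X μ = div_μ(X) • μ`. -/
def divergence (μ : DiffForm (n + 1) (n + 1) M) (X : ∀ x : M, TangentSpace (𝓡 (n + 1)) x)
    (x : M) : ℝ :=
  lieDerivative X μ x (frame x) / μ x (frame x)

theorem divergence_spec {μ : DiffForm (n + 1) (n + 1) M} (hμ : IsVolumeForm μ)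
    (X : ∀ x : M, TangentSpace (𝓡 (n + 1)) x) (x : M) :
    lieDerivative X μ x = divergence μ X x • μ x :=
  eq_ratio_smul x _ _ (hμ.ne_zero x)

/-- The subset `Z` of the `d`-manifold `M` has codimension at least two: in coordinates, it is
empty or its Hausdorff dimension is at most `d - 2`. -/
def HasCodimAtLeastTwo {d : ℕ} {M : Type*} [TopologicalSpace M] [ChartedSpace (Eucl d) M]
    (Z : Set M) : Prop :=
  ∀ x₀ : M, (Z ∩ (extChartAt (𝓡 d) x₀).source).Nonempty →
    dimH (extChartAt (𝓡 d) x₀ '' (Z ∩ (extChartAt (𝓡 d) x₀).source)) + 2 ≤ (d : ENNReal)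

end Divergence

/-- A hybrid dynamical system `(M, S, X, Δ)` on a manifold `M` of dimension `n + 1`. -/
structure HybridSystem (n : ℕ) (M : Type*) [TopologicalSpace M]
    [ChartedSpace (Eucl (n + 1)) M] [IsManifold (𝓡 (n + 1)) ∞ M] where
  /-- the impact surface -/
  S : Set M
  /-- `S` is a smooth embedded submanifold of dimension `n`, i.e. of codimension one -/
  chartedSpace_S : ChartedSpace (Eucl n) S
  isManifold_S : IsManifold (𝓡 n) ∞ S
  isSmoothEmbedding_S :
    Manifold.IsSmoothEmbedding (𝓡 n) (𝓡 (n + 1)) ∞ (Subtype.val : S → M)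
  /-- the continuous dynamics -/
  X : ∀ x : M, TangentSpace (𝓡 (n + 1)) x
  contMDiff_X : ContMDiff (𝓡 (n + 1)) (𝓡 (n + 1)).tangent ∞
    (fun x => (⟨x, X x⟩ : TangentBundle (𝓡 (n + 1)) M))
  /-- the impact map -/
  Δ : S → M
  contMDiff_Δ : ContMDiff (𝓡 n) (𝓡 (n + 1)) ∞ Δ
  disjoint_S_range : Disjoint S (Set.range Δ)
  codim_closures : HasCodimAtLeastTwo (d := n + 1) (closure S ∩ closure (Set.range Δ))

namespace HybridSystem

variable {n : ℕ} {M : Type*} [TopologicalSpace M] [ChartedSpace (Eucl (n + 1)) M]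
  [IsManifold (𝓡 (n + 1)) ∞ M] (H : HybridSystem n M)

instance : ChartedSpace (Eucl n) H.S := H.chartedSpace_S

instance : IsManifold (𝓡 n) ∞ H.S := H.isManifold_S

/-- The inclusion `ι_S : S → M`. -/
def incl : H.S → M := Subtype.val

/-- The hybrid flow: `H.FlowsTo t x y` says that `φ_t^H(x)` is defined and equals `y`, where
`t ≥ 0`. The trajectory follows `X` until it meets `S`, is then reset by `Δ`, and so on, with
finitely many impacts up to time `t`. At an impact time the value is the state immediately before
the reset. -/
inductive FlowsTo : ℝ → M → M → Prop
  | flow {t : ℝ} {x y : M} (γ : ℝ → M) (ht : 0 ≤ t)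
      (hγ : IsMIntegralCurveOn (I := 𝓡 (n + 1)) γ H.X (Set.Icc 0 t))
      (h_avoid : ∀ s ∈ Set.Ico 0 t, γ s ∉ H.S)
      (h_start : γ 0 = x) (h_end : γ t = y) : FlowsTo t x y
  | impact {τ t : ℝ} {x y : M} (γ : ℝ → M) (p : H.S) (hτ : 0 ≤ τ) (ht : 0 < t)
      (hγ : IsMIntegralCurveOn (I := 𝓡 (n + 1)) γ H.X (Set.Icc 0 τ))
      (h_avoid : ∀ s ∈ Set.Ico 0 τ, γ s ∉ H.S)
      (h_start : γ 0 = x) (h_hit : γ τ = H.incl p)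
      (h_rest : FlowsTo t (H.Δ p) y) : FlowsTo (τ + t) x y

/-- A smooth hybrid system: a trajectory that reaches `closure S \ S` stays off `S` for a short
time afterwards, and `T_x M = T_x S ⊕ ℝ X(x)` for every `x ∈ S`. -/
structure IsSmooth : Prop where
  off_boundary : ∀ (t : ℝ) (x y : M), H.FlowsTo t x y → y ∈ closure H.S \ H.S →
    ∃ ε > 0, ∀ δ, 0 < δ → δ < ε → ∃ z, H.FlowsTo (t + δ) x z ∧ z ∉ H.S
  transverse : ∀ p : H.S,
    IsCompl (mfderiv (𝓡 n) (𝓡 (n + 1)) H.incl p).range (Submodule.span ℝ {H.X (H.incl p)})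

/-- The form `α` is hybrid-invariant, `(φ_t^H)^* α = α`: the identity holds at time `t ≥ 0` on
every open set `U`, disjoint from `S`, on which `φ_t^H` is defined and smooth. -/
def IsHybridInvariant {k : ℕ} (α : DiffForm (n + 1) k M) : Prop :=
  ∀ t : ℝ, 0 ≤ t → ∀ U : Set M, IsOpen U → Disjoint U H.S →
    ∀ F : M → M, (∀ x ∈ U, H.FlowsTo t x (F x)) →
      ContMDiffOn (𝓡 (n + 1)) (𝓡 (n + 1)) ∞ F U →
        ∀ x ∈ U, pullback F α x = α x

/-- The hybrid Jacobian `J_μ(Δ) : S → ℝ`, the function with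
`Δ^* (i_X μ) = J_μ(Δ) • ι_S^* (i_X μ)`. -/
def hybridJacobian (μ : DiffForm (n + 1) (n + 1) M) (p : H.S) : ℝ :=
  pullback (m := n) H.Δ (interior H.X μ) p (frame (n := n) p) / pullback (m := n) H.incl (interior H.X μ) p (frame (n := n) p)

/-- By transversality, `ι_S^* (i_X μ)` vanishes nowhere on `S`. -/
theorem pullback_incl_ne_zero (hH : H.IsSmooth) {μ : DiffForm (n + 1) (n + 1) M}
    (hμ : IsVolumeForm μ) (p : H.S) : pullback (m := n) H.incl (interior H.X μ) p ≠ 0 := by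
  intro h0
  have hc := hH.transverse p
  set L : Eucl n →ₗ[ℝ] Eucl (n + 1) :=
    (mfderiv (𝓡 n) (𝓡 (n + 1)) H.incl p).toLinearMap with hL
  set v : Eucl (n + 1) := H.X (H.incl p) with hv
  have hc' : IsCompl (LinearMap.range L) (Submodule.span ℝ {v}) := hc
  set e : Fin n → Eucl n := fun i => EuclideanSpace.basisFun (Fin n) ℝ i with he
  have hspan : Submodule.span ℝ (Set.range e) = ⊤ := by
    have := (EuclideanSpace.basisFun (Fin n) ℝ).toBasis.span_eq
    rwa [OrthonormalBasis.coe_toBasis] at this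
  set w : Fin (n + 1) → Eucl (n + 1) := Fin.cons v (L ∘ e) with hw
  have htop : Submodule.span ℝ (Set.range w) = ⊤ := by
    rw [hw, Fin.range_cons, Submodule.span_insert, Set.range_comp, ← Submodule.map_span, hspan,
      Submodule.map_top, sup_comm]
    exact hc'.sup_eq_top
  let b : Module.Basis (Fin (n + 1)) ℝ (Eucl (n + 1)) :=
    basisOfTopLeSpanOfCardEqFinrank w htop.ge (by simp)
  have hbw : (b : Fin (n + 1) → Eucl (n + 1)) = w :=
    coe_basisOfTopLeSpanOfCardEqFinrank w htop.ge (by simp)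
  let ν : Eucl (n + 1) [⋀^Fin (n + 1)]→L[ℝ] ℝ := μ (H.incl p)
  have hval : ν w = 0 := by
    have h1 := congrArg (fun f : Eucl n [⋀^Fin n]→L[ℝ] ℝ => f e) h0
    exact h1
  apply hμ.ne_zero (H.incl p)
  change ν = 0
  apply ContinuousAlternatingMap.toAlternatingMap_injective
  rw [ν.toAlternatingMap.eq_smul_basis_det b, hbw]
  have h2 : ν.toAlternatingMap w = 0 := hval
  rw [h2, zero_smul]
  rfl

/-- The defining property of the hybrid Jacobian. -/
theorem hybridJacobian_spec (hH : H.IsSmooth) {μ : DiffForm (n + 1) (n + 1) M}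
    (hμ : IsVolumeForm μ) (p : H.S) :
    pullback (m := n) H.Δ (interior H.X μ) p =
      H.hybridJacobian μ p • pullback (m := n) H.incl (interior H.X μ) p :=
  eq_ratio_smul (n := n) p _ _ (H.pullback_incl_ne_zero hH hμ p)

/-- `g` is a smooth solution of the hybrid cohomology equation. The logarithm of the hybrid
Jacobian has to make sense, so the Jacobian is positive. -/
structure SolvesHybridCohomology (μ : DiffForm (n + 1) (n + 1) M) (g : M → ℝ) : Prop where
  smooth : ContMDiff (𝓡 (n + 1)) 𝓘(ℝ, ℝ) ∞ g
  continuous_part : ∀ x, mfderiv (𝓡 (n + 1)) 𝓘(ℝ, ℝ) g x (H.X x) = -divergence μ H.X x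
  jacobian_pos : ∀ p : H.S, 0 < H.hybridJacobian μ p
  discrete_part : ∀ p : H.S,
    g (H.Δ p) - g (H.incl p) = -Real.log (H.hybridJacobian μ p)

end HybridSystem

end HybridDyn

end

/-! Put `α = c e^g μ`. The first cohomology equation says that `L_X α = 0`, so the flow of `X`
preserves `α`. The second, exponentiated, says `e^(g ∘ Δ) J = e^g` on `S`, that is, `Δ^*(i_X α) =
ι_S^*(i_X α)`. Across an impact the derivative of the hybrid flow sends `dι u + s X` to `dΔ u + s
X`, where `s` accounts for the variation of the impact time. As `α` has top degree, equality of the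
contracted forms means that this linear map preserves `α` (`exp_smul_reset`).

The difficulty is global: the pattern of impacts may change from point to point of `U`, so a smooth
time-`t` map `F` need not be given near a point by one sequence of flows and resets. The hybrid flow
is therefore cut into local steps acting on pairs (state, remaining time): flowing until the
remaining time is a prescribed rational (`exists_flowStep`), and flowing to `S` followed by a reset
(`exists_impactStep`). Each step is defined on an open set and carries along `PreservesAt`, the
first-order form of `(φ_s ∘ G)^* α = α`, which mentions only the local data `dG`, `ds` and `X`.

By second countability, countably many steps realise every trajectory (`exists_steps`), so `U` is a
countable union of sets on which `F` agrees with a fixed word of steps. By Baire's theorem the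
closures of these sets have dense interior in `U`. There the word is locally continuous and agrees
with `F` on a dense set, hence locally, and `F^* α = α` holds at a dense set of points
(`exists_pullback_eq`). Since `F` and `α` are smooth, the equality extends to all of `U`
(`pullback_eq_of_frequently`).

The steps rest on local flows differentiable in the initial condition (`exists_isLocalFlow`), on
flow boxes around `S` (`exists_flowBox`), and on the coordinate calculus of the Lie derivative. -/

namespace HybridDyn

/-! ### Linearised equations and the notion of a local flow -/

section LocalFlow

open Set Filter Metric Function
open scoped NNReal

variable {E : Type*} [NormedAddCommGroup E] [NormedSpace ℝ E]

/-- The derivative of the flow with respect to the initial condition: if `D` solves the linearised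
equation along the trajectory `p`, then a nearby trajectory `q` agrees with `p + D (q 0 - p 0)` up
to an error that is quadratic in `q 0 - p 0`. -/
theorem norm_sub_sub_linearized_le {Z : E → E} {B : Set E} {K : ℝ≥0} {C T : ℝ} (hK : 0 < K)
    (hC : 0 ≤ C) (hT : 0 ≤ T) {A D : ℝ → E →L[ℝ] E} {p q : ℝ → E} (hZ : LipschitzOnWith K Z B)
    (hp : ∀ s ∈ Icc 0 T, HasDerivAt p (Z (p s)) s) (hpB : ∀ s ∈ Icc 0 T, p s ∈ B)
    (hq : ∀ s ∈ Icc 0 T, HasDerivAt q (Z (q s)) s) (hqB : ∀ s ∈ Icc 0 T, q s ∈ B)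
    (hA : ∀ s ∈ Icc 0 T, ‖A s‖ ≤ K)
    (hquad : ∀ s ∈ Icc 0 T, ‖Z (q s) - Z (p s) - A s (q s - p s)‖ ≤ C * ‖q s - p s‖ ^ 2)
    (hD : ∀ s ∈ Icc 0 T, HasDerivAt D (A s ∘L D s) s) (hD0 : D 0 = 1) :
    ‖q T - p T - D T (q 0 - p 0)‖ ≤
      C * Real.exp (K * T) ^ 2 / K * (Real.exp (K * T) - 1) * ‖q 0 - p 0‖ ^ 2 := by
  set h := q 0 - p 0 with hh
  have hdist : ∀ s ∈ Icc 0 T, ‖q s - p s‖ ≤ ‖h‖ * Real.exp (K * T) := by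
    intro s hs
    have h1 := dist_le_of_trajectories_ODE_of_mem (v := fun _ => Z) (s := fun _ => B) (a := 0)
      (b := T) (δ := ‖h‖) (fun _ _ => hZ)
      (fun s hs => (hq s hs).continuousAt.continuousWithinAt)
      (fun s hs => (hq s (Ico_subset_Icc_self hs)).hasDerivWithinAt)
      (fun s hs => hqB s (Ico_subset_Icc_self hs))
      (fun s hs => (hp s hs).continuousAt.continuousWithinAt)
      (fun s hs => (hp s (Ico_subset_Icc_self hs)).hasDerivWithinAt)
      (fun s hs => hpB s (Ico_subset_Icc_self hs)) (by rw [dist_eq_norm]) s hs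
    rw [dist_eq_norm] at h1
    refine h1.trans ?_
    gcongr
    linarith [hs.2]
  have hu : ∀ s ∈ Icc 0 T, HasDerivAt (fun s => q s - p s - D s h)
      (Z (q s) - Z (p s) - A s (D s h)) s := by
    intro s hs
    exact (((hq s hs).sub (hp s hs)).sub
      ((hD s hs).clm_apply (hasDerivAt_const s h))).congr_deriv (by simp)
  -- The error `e = q - p - D h` vanishes at time `0` and satisfies `e' = A e + ρ`, where `ρ` is the
  -- Taylor remainder of `Z`, of size at most `C (‖h‖ exp (K T))²`; Grönwall's inequality applies.
  have h2 := norm_le_gronwallBound_of_norm_deriv_right_le (δ := 0) (K := K)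
    (ε := C * (‖h‖ * Real.exp (K * T)) ^ 2) (a := 0) (b := T)
    (fun s hs => (hu s hs).continuousAt.continuousWithinAt)
    (fun s hs => (hu s (Ico_subset_Icc_self hs)).hasDerivWithinAt) (by simp [hD0, hh])
    (by
      intro s hs
      have hs' := Ico_subset_Icc_self hs
      have e : Z (q s) - Z (p s) - A s (D s h) =
          A s (q s - p s - D s h) + (Z (q s) - Z (p s) - A s (q s - p s)) := by
        simp only [map_sub]; abel
      rw [e]
      refine (norm_add_le _ _).trans (add_le_add ?_ ?_)
      · exact (A s).le_of_opNorm_le (hA s hs') _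
      · refine (hquad s hs').trans ?_
        gcongr
        exact hdist s hs') T ⟨hT, le_rfl⟩
  refine h2.trans (le_of_eq ?_)
  rw [gronwallBound_of_K_ne_0 (by exact_mod_cast hK.ne')]
  simp only [sub_zero, zero_mul, zero_add]
  ring

/-- Solutions of a linear equation depend exponentially on time. -/
theorem norm_sub_one_le_of_linear {K : ℝ≥0} (hK : 0 < K) {T : ℝ} (hT : 0 ≤ T)
    {A D : ℝ → E →L[ℝ] E} (hA : ∀ s ∈ Icc 0 T, ‖A s‖ ≤ K)
    (hD : ∀ s ∈ Icc 0 T, HasDerivAt D (A s ∘L D s) s) (hD0 : D 0 = 1) :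
    ‖D T - 1‖ ≤ Real.exp (K * T) - 1 := by
  have h2 := norm_le_gronwallBound_of_norm_deriv_right_le (f := fun s => D s - 1) (δ := 0) (K := K)
    (ε := K) (a := 0) (b := T)
    (fun s hs => ((hD s hs).sub_const 1).continuousAt.continuousWithinAt)
    (fun s hs => ((hD s (Ico_subset_Icc_self hs)).sub_const 1).hasDerivWithinAt) (by simp [hD0])
    (by
      intro s hs
      have hs' := Ico_subset_Icc_self hs
      have e : A s ∘L D s = A s ∘L (D s - 1) + A s := by
        ext v; simp
      rw [e]
      refine (norm_add_le _ _).trans (add_le_add ?_ (hA s hs'))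
      refine ((A s).opNorm_comp_le _).trans ?_
      gcongr
      exact hA s hs') T ⟨hT, le_rfl⟩
  refine h2.trans (le_of_eq ?_)
  have hK' : (K : ℝ) ≠ 0 := by exact_mod_cast hK.ne'
  rw [gronwallBound_of_K_ne_0 hK']
  simp [hK']

/-- Local existence for linear equations. -/
theorem exists_linear_solution [CompleteSpace E] {K : ℝ≥0} {ε : ℝ} (hε : 0 < ε)
    (hKε : 2 * K * ε ≤ 1) {A : ℝ → E →L[ℝ] E} (hA : ContinuousOn A (Icc (-ε) ε))
    (hAK : ∀ s ∈ Icc (-ε) ε, ‖A s‖ ≤ K) :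
    ∃ D : ℝ → E →L[ℝ] E, D 0 = 1 ∧ ∀ s ∈ Ioo (-ε) ε, HasDerivAt D (A s ∘L D s) s := by
  -- Picard–Lindelöf in the unit ball around the identity operator: there `‖L‖ ≤ 2`, so the speed is
  -- at most `2K`, and `2Kε ≤ 1` keeps the solution in the ball.
  have hpl : IsPicardLindelof (fun s (L : E →L[ℝ] E) => A s ∘L L) (tmin := -ε) (tmax := ε)
      ⟨0, by constructor <;> linarith⟩ 1 1 0 (2 * K) K := by
    refine ⟨?_, ?_, ?_, ?_⟩
    · intro s hs
      refine LipschitzOnWith.of_dist_le_mul fun L _ L' _ => ?_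
      rw [dist_eq_norm, dist_eq_norm, ← ContinuousLinearMap.comp_sub]
      refine ((A s).opNorm_comp_le _).trans ?_
      gcongr
      exact hAK s hs
    · intro L _
      exact hA.clm_comp continuousOn_const
    · intro s hs L hL
      have h1 : ‖(1 : E →L[ℝ] E)‖ ≤ 1 := ContinuousLinearMap.norm_id_le
      have h2 : ‖L‖ ≤ 2 := by
        have := norm_le_norm_add_norm_sub' L 1
        rw [mem_closedBall, dist_eq_norm] at hL
        have h3 : ((1 : ℝ≥0) : ℝ) = 1 := rfl
        linarith
      refine ((A s).opNorm_comp_le _).trans ?_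
      push_cast
      rw [mul_comm]
      have := hAK s hs
      gcongr
    · push_cast
      simp only [sub_zero, zero_sub, neg_neg, max_self]
      linarith
  obtain ⟨D, hD0, hD⟩ := hpl.exists_eq_forall_mem_Icc_hasDerivWithinAt₀
  exact ⟨D, hD0, fun s hs => (hD s (Ioo_subset_Icc_self hs)).hasDerivAt (Icc_mem_nhds hs.1 hs.2)⟩

/-- `Φ` is a local flow of the vector field `Y`, defined for initial conditions in `V` and times in
`(-ε, ε)`, with values in `Ω`; `D σ y` is the derivative of `Φ σ` at `y`. -/
structure IsLocalFlow (Y : E → E) (Ω V : Set E) (ε : ℝ) (Φ : ℝ → E → E)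
    (D : ℝ → E → E →L[ℝ] E) : Prop where
  isOpen : IsOpen V
  pos : 0 < ε
  subset : V ⊆ Ω
  map_zero : ∀ y ∈ V, Φ 0 y = y
  mem : ∀ y ∈ V, ∀ σ ∈ Ioo (-ε) ε, Φ σ y ∈ Ω
  hasDerivAt : ∀ y ∈ V, ∀ σ ∈ Ioo (-ε) ε, HasDerivAt (fun s => Φ s y) (Y (Φ σ y)) σ
  D_zero : ∀ y ∈ V, D 0 y = 1
  hasDerivAt_D : ∀ y ∈ V, ∀ σ ∈ Ioo (-ε) ε,
    HasDerivAt (fun s => D s y) (fderiv ℝ Y (Φ σ y) ∘L D σ y) σ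
  hasFDerivAt_space : ∀ y ∈ V, ∀ σ ∈ Ioo (-ε) ε, HasFDerivAt (Φ σ) (D σ y) y
  hasFDerivAt : ∀ y ∈ V, ∀ σ ∈ Ioo (-ε) ε, HasFDerivAt (uncurry Φ)
    ((ContinuousLinearMap.toSpanSingleton ℝ (Y (Φ σ y))).coprod (D σ y)) (σ, y)
  D_apply : ∀ y ∈ V, ∀ σ ∈ Ioo (-ε) ε, D σ y (Y y) = Y (Φ σ y)
  continuousAt_D : ∀ y ∈ V, ContinuousAt (uncurry D) (0, y)
  continuousAt_field : ∀ y ∈ Ω, ContinuousAt Y y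
  eq_right : ∀ (c : ℝ → E) (a b : ℝ), a ≤ b → b - a < ε → (∀ u ∈ Icc a b, c u ∈ V) →
    (∀ u ∈ Icc a b, HasDerivWithinAt c (Y (c u)) (Icc a b) u) → Φ (b - a) (c a) = c b
  eq_left : ∀ (c : ℝ → E) (a b : ℝ), a ≤ b → b - a < ε → (∀ u ∈ Icc a b, c u ∈ V) →
    (∀ u ∈ Icc a b, HasDerivWithinAt c (Y (c u)) (Icc a b) u) → Φ (a - b) (c b) = c a

end LocalFlow

/-! ### Existence of local flows and their dependence on the initial condition -/

section LocalFlowExistence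

open Set Filter Metric Function
open scoped NNReal

variable {E : Type*} [NormedAddCommGroup E] [NormedSpace ℝ E]

/-- A `C²` vector field is regular, with uniform bounds, on a small ball. -/
theorem exists_regular_ball {Y : E → E} {y₀ : E} {Ω : Set E} (hY : ContDiffAt ℝ 2 Y y₀)
    (hΩ : Ω ∈ 𝓝 y₀) :
    ∃ R > 0, ∃ K : ℝ≥0, 0 < K ∧ ∃ C : ℝ, 0 ≤ C ∧ ball y₀ R ⊆ Ω ∧
      (∀ y ∈ ball y₀ R, DifferentiableAt ℝ Y y) ∧ LipschitzOnWith K Y (ball y₀ R) ∧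
      (∀ y ∈ ball y₀ R, ‖fderiv ℝ Y y‖ ≤ K) ∧ ContinuousOn (fderiv ℝ Y) (ball y₀ R) ∧
      ∀ y ∈ ball y₀ R, ∀ y' ∈ ball y₀ R,
        ‖Y y' - Y y - fderiv ℝ Y y (y' - y)‖ ≤ C * ‖y' - y‖ ^ 2 := by
  have hd : ContDiffAt ℝ 1 (fderiv ℝ Y) y₀ := hY.fderiv_right (by norm_num)
  obtain ⟨C, s, hs, hC⟩ := hd.exists_lipschitzOnWith
  have h1 : ∀ᶠ y in 𝓝 y₀, ContDiffAt ℝ 2 Y y := hY.eventually (by simp)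
  have h2 : ∀ᶠ y in 𝓝 y₀, ‖fderiv ℝ Y y‖ < ‖fderiv ℝ Y y₀‖ + 1 :=
    hd.continuousAt.norm.eventually_lt_const (by linarith)
  obtain ⟨R, hR, hball⟩ := eventually_nhds_iff_ball.1
    (((h1.and h2).and (eventually_mem_set.2 hs)).and (eventually_mem_set.2 hΩ))
  have hdiff : ∀ y ∈ ball y₀ R, DifferentiableAt ℝ Y y := fun y hy =>
    (hball y hy).1.1.1.differentiableAt (by norm_num)
  set K : ℝ≥0 := ⟨‖fderiv ℝ Y y₀‖ + 1, by positivity⟩ with hK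
  have hbd : ∀ y ∈ ball y₀ R, ‖fderiv ℝ Y y‖ ≤ K := fun y hy => (hball y hy).1.1.2.le
  have hCs : LipschitzOnWith C (fderiv ℝ Y) (ball y₀ R) := hC.mono fun y hy => (hball y hy).1.2
  refine ⟨R, hR, K, ?_, C, C.2, fun y hy => (hball y hy).2, hdiff, ?_, hbd, hCs.continuousOn, ?_⟩
  · rw [← NNReal.coe_pos]
    change 0 < ‖fderiv ℝ Y y₀‖ + 1
    positivity
  · exact (convex_ball y₀ R).lipschitzOnWith_of_nnnorm_fderiv_le hdiff
      fun y hy => by exact_mod_cast hbd y hy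
  · intro y hy y' hy'
    have hseg : segment ℝ y y' ⊆ ball y₀ R := (convex_ball y₀ R).segment_subset hy hy'
    -- Mean value inequality for `Y - fderiv ℝ Y y` on the segment, where the derivative of `Y`
    -- differs from that at `y` by at most `C ‖y' - y‖`.
    have := (convex_segment (𝕜 := ℝ) y y').norm_image_sub_le_of_norm_fderiv_le'
      (f := Y) (φ := fderiv ℝ Y y) (C := C * ‖y' - y‖) (fun z hz => hdiff z (hseg hz))
      (fun z hz => by
        have h3 := hCs.dist_le_mul z (hseg hz) y hy
        rw [dist_eq_norm, dist_eq_norm] at h3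
        refine h3.trans ?_
        gcongr
        exact norm_sub_le_of_mem_segment hz)
      (left_mem_segment ℝ y y') (right_mem_segment ℝ y y')
    refine this.trans (le_of_eq (by ring))

/-- A `C²` vector field has a local flow around each point. -/
theorem exists_isLocalFlow [CompleteSpace E] {Y : E → E} {y₀ : E} {Ω : Set E}
    (hY : ContDiffAt ℝ 2 Y y₀) (hΩ : Ω ∈ 𝓝 y₀) :
    ∃ Ω' ⊆ Ω, ∃ V ε Φ D, y₀ ∈ V ∧ IsLocalFlow Y Ω' V ε Φ D := by
  obtain ⟨R, hR, K, hK, C, hC, hBΩ, hdiff, hlip, hbd, hcd, hquad⟩ := exists_regular_ball hY hΩ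
  obtain ⟨ε₀, hε₀, a, r, L, K', hr, hpl⟩ := IsPicardLindelof.of_contDiffAt_one
    (hY.of_le (by norm_num : (1 : WithTop ℕ∞) ≤ 2))
  obtain ⟨α, hα, hαc⟩ :=
    (hpl 0).exists_forall_mem_closedBall_eq_hasDerivWithinAt_continuousOn
  simp only [zero_sub, zero_add] at hα hαc
  have hr' : (0 : ℝ) < r := by exact_mod_cast hr
  have hnhds : closedBall y₀ (r : ℝ) ×ˢ Icc (-ε₀) ε₀ ∈ 𝓝 (y₀, (0 : ℝ)) :=
    prod_mem_nhds (closedBall_mem_nhds y₀ hr') (Icc_mem_nhds (by linarith) hε₀)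
  have hα0 : α (y₀, 0) = y₀ := (hα y₀ (mem_closedBall_self hr'.le)).1
  have hev : ∀ᶠ z in 𝓝 (y₀, (0 : ℝ)), α z ∈ ball y₀ R := by
    have := (hαc.continuousAt hnhds).eventually_mem
      (s := ball y₀ R) (by rw [hα0]; exact ball_mem_nhds y₀ hR)
    exact this
  obtain ⟨η, hη, hηsub⟩ := eventually_nhds_iff_ball.1
    ((hev.and (eventually_mem_set.2 hnhds)).and
      (eventually_mem_set.2 (prod_mem_nhds (ball_mem_nhds y₀ hR) univ_mem)))
  -- The bound `η / 2` keeps `[-ε, ε]` well inside the ball of radius `η`; the bound `1 / (2K)` is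
  -- what `exists_linear_solution` asks for.
  set ε : ℝ := min (η / 2) (1 / (2 * K)) with hεdef
  have hK' : (0 : ℝ) < K := by exact_mod_cast hK
  have hε : 0 < ε := lt_min (by linarith) (by positivity)
  have hKε : 2 * K * ε ≤ 1 := by
    calc 2 * K * ε ≤ 2 * K * (1 / (2 * K)) := by gcongr; exact min_le_right _ _
      _ = 1 := by field_simp
  set V := ball y₀ η with hV
  have key : ∀ y ∈ V, ∀ σ ∈ Icc (-ε) ε, (y, σ) ∈ ball (y₀, (0 : ℝ)) η := by
    intro y hy σ hσ
    have h1 : ε < η := (min_le_left _ _).trans_lt (by linarith)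
    rw [← ball_prod_same]
    refine ⟨hy, ?_⟩
    rw [Real.ball_eq_Ioo]
    exact ⟨by linarith [hσ.1], by linarith [hσ.2]⟩
  have hmem : ∀ y ∈ V, ∀ σ ∈ Icc (-ε) ε, α (y, σ) ∈ ball y₀ R := fun y hy σ hσ =>
    (hηsub _ (key y hy σ hσ)).1.1
  -- The product ball of radius `η` lies in the domain of the Picard–Lindelöf flow, so `3η/4 ≤ ε₀`,
  -- whereas `ε ≤ η/2`.
  have hεε₀ : ε < ε₀ := by
    have h0 : y₀ ∈ V := mem_ball_self hη
    by_contra hcon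
    push Not at hcon
    have h1 : (3 / 4 * η) < η := by linarith
    have h2 : (y₀, 3 / 4 * η) ∈ ball (y₀, (0 : ℝ)) η := by
      rw [← ball_prod_same, Real.ball_eq_Ioo]
      exact ⟨h0, by constructor <;> linarith⟩
    have h3 : 3 / 4 * η ≤ ε₀ := (hηsub _ h2).1.2.2.2
    have h4 : ε ≤ η / 2 := min_le_left _ _
    linarith
  have hVr : ∀ y ∈ V, y ∈ closedBall y₀ (r : ℝ) := fun y hy =>
    (hηsub _ (key y hy 0 ⟨by linarith, hε.le⟩)).1.2.1
  have hVB : V ⊆ ball y₀ R := fun y hy =>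
    (hηsub _ (key y hy 0 ⟨by linarith, hε.le⟩)).2.1
  have hzero : ∀ y ∈ V, α (y, 0) = y := fun y hy => (hα y (hVr y hy)).1
  have hder : ∀ y ∈ V, ∀ σ ∈ Icc (-ε) ε, HasDerivAt (fun s => α (y, s)) (Y (α (y, σ))) σ := by
    intro y hy σ hσ
    exact ((hα y (hVr y hy)).2 σ ⟨by linarith [hσ.1], by linarith [hσ.2]⟩).hasDerivAt
      (Icc_mem_nhds (by linarith [hσ.1]) (by linarith [hσ.2]))
  have hcont : ∀ y ∈ V, ∀ σ ∈ Icc (-ε) ε, ContinuousAt α (y, σ) := by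
    intro y hy σ hσ
    have h1 : ball (y₀, (0 : ℝ)) η ⊆ closedBall y₀ (r : ℝ) ×ˢ Icc (-ε₀) ε₀ := fun z hz =>
      (hηsub z hz).1.2
    exact hαc.continuousAt (mem_of_superset (isOpen_ball.mem_nhds (key y hy σ hσ)) h1)
  have hDex : ∀ y, y ∈ V → ∃ D : ℝ → E →L[ℝ] E, D 0 = 1 ∧ ∀ s ∈ Ioo (-ε) ε,
      HasDerivAt D (fderiv ℝ Y (α (y, s)) ∘L D s) s := by
    intro y hy
    refine exists_linear_solution hε hKε (A := fun s => fderiv ℝ Y (α (y, s))) ?_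
      fun s hs => hbd _ (hmem y hy s hs)
    exact hcd.comp (fun s hs => (hder y hy s hs).continuousAt.continuousWithinAt)
      fun s hs => hmem y hy s hs
  choose! D hD0 hD using hDex
  have hspace : ∀ σ ∈ Ioo (-ε) ε, ∃ C' : ℝ, ∀ y ∈ V, ∀ y' ∈ V,
      ‖α (y', σ) - α (y, σ) - D y σ (y' - y)‖ ≤ C' * ‖y' - y‖ ^ 2 := by
    intro σ hσ
    rcases le_total 0 σ with h0 | h0
    · refine ⟨C * Real.exp (K * σ) ^ 2 / K * (Real.exp (K * σ) - 1), fun y hy y' hy' => ?_⟩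
      have hsub : ∀ s ∈ Icc 0 σ, s ∈ Icc (-ε) ε := fun s hs =>
        ⟨by linarith [hs.1], by linarith [hs.2, hσ.2]⟩
      have hsub' : ∀ s ∈ Icc 0 σ, s ∈ Ioo (-ε) ε := fun s hs =>
        ⟨by linarith [hs.1], by linarith [hs.2, hσ.2]⟩
      have := norm_sub_sub_linearized_le hK hC h0 (D := D y) hlip
        (fun s hs => hder y hy s (hsub s hs)) (fun s hs => hmem y hy s (hsub s hs))
        (fun s hs => hder y' hy' s (hsub s hs)) (fun s hs => hmem y' hy' s (hsub s hs))
        (fun s hs => hbd _ (hmem y hy s (hsub s hs)))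
        (fun s hs => hquad _ (hmem y hy s (hsub s hs)) _ (hmem y' hy' s (hsub s hs)))
        (fun s hs => hD y hy s (hsub' s hs)) (hD0 y hy)
      simpa only [hzero y hy, hzero y' hy'] using this
    · refine ⟨C * Real.exp (K * -σ) ^ 2 / K * (Real.exp (K * -σ) - 1), fun y hy y' hy' => ?_⟩
      have hsub : ∀ s ∈ Icc 0 (-σ), -s ∈ Icc (-ε) ε := fun s hs =>
        ⟨by linarith [hs.2, hσ.1], by linarith [hs.1]⟩
      have hsub' : ∀ s ∈ Icc 0 (-σ), -s ∈ Ioo (-ε) ε := fun s hs =>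
        ⟨by linarith [hs.2, hσ.1], by linarith [hs.1]⟩
      -- Negative times are positive times for the field `-Y`.
      have hrev : ∀ y ∈ V, ∀ s ∈ Icc 0 (-σ),
          HasDerivAt (fun s => α (y, -s)) ((fun z => -Y z) (α (y, -s))) s := by
        intro y hy s hs
        exact ((hder y hy (-s) (hsub s hs)).scomp s (hasDerivAt_neg s)).congr_deriv (by simp)
      have := norm_sub_sub_linearized_le (Z := fun z => -Y z) hK hC (neg_nonneg.2 h0)
        (A := fun s => -fderiv ℝ Y (α (y, -s))) (D := fun s => D y (-s)) hlip.neg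
        (hrev y hy) (fun s hs => hmem y hy _ (hsub s hs))
        (hrev y' hy') (fun s hs => hmem y' hy' _ (hsub s hs))
        (fun s hs => by rw [norm_neg]; exact hbd _ (hmem y hy _ (hsub s hs)))
        (fun s hs => by
          refine le_trans (le_of_eq ?_)
            (hquad _ (hmem y hy _ (hsub s hs)) _ (hmem y' hy' _ (hsub s hs)))
          rw [← norm_neg]
          congr 1
          simp only [neg_apply]
          abel)
        (fun s hs => ((hD y hy _ (hsub' s hs)).scomp s (hasDerivAt_neg s)).congr_deriv
          (by ext; simp)) (by simpa using hD0 y hy)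
      simpa only [hzero y hy, hzero y' hy', neg_zero, neg_neg] using this
  have hVopen : IsOpen V := isOpen_ball
  have hfd : ∀ y ∈ V, ∀ σ ∈ Ioo (-ε) ε, HasFDerivAt (fun y' => α (y', σ)) (D y σ) y := by
    intro y hy σ hσ
    obtain ⟨C', hC'⟩ := hspace σ hσ
    rw [hasFDerivAt_iff_isLittleO]
    refine (Asymptotics.IsBigO.of_bound C' ?_).trans_isLittleO
      (Asymptotics.isLittleO_pow_sub_sub y (one_lt_two))
    filter_upwards [hVopen.mem_nhds hy] with y' hy'
    simpa using hC' y hy y' hy'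
  have hYc : ∀ y ∈ ball y₀ R, ContinuousAt Y y := fun y hy => (hdiff y hy).continuousAt
  refine ⟨ball y₀ R, hBΩ, V, ε, fun σ y => α (y, σ), fun σ y => D y σ, mem_ball_self hη,
    hVopen, hε, hVB, hzero, fun y hy σ hσ => hmem y hy σ (Ioo_subset_Icc_self hσ),
    fun y hy σ hσ => hder y hy σ (Ioo_subset_Icc_self hσ), hD0, hD, hfd, ?_, ?_, ?_, hYc, ?_, ?_⟩
  · intro y hy σ hσ
    rw [hasFDerivAt_iff_isLittleO]
    have hI : Ioo (-ε) ε ∈ 𝓝 σ := isOpen_Ioo.mem_nhds hσ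
    -- The increment of the flow splits into a time increment at the moving point `z.2`, estimated
    -- uniformly by the mean value inequality, and a space increment at the fixed time `σ`.
    have htime : (fun z : ℝ × E => α (z.2, z.1) - α (z.2, σ) -
        (ContinuousLinearMap.toSpanSingleton ℝ (Y (α (y, σ)))) (z.1 - σ))
          =o[𝓝 (σ, y)] fun z => z.1 - σ := by
      rw [Asymptotics.isLittleO_iff]
      intro θ hθ
      have h1 : ContinuousAt (fun z : ℝ × E => α (z.2, z.1)) (σ, y) :=
        (hcont y hy σ (Ioo_subset_Icc_self hσ)).comp
          (f := fun z : ℝ × E => (z.2, z.1)) (x := (σ, y)) continuous_swap.continuousAt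
      have h2 : ContinuousAt (fun z : ℝ × E => Y (α (z.2, z.1))) (σ, y) :=
        ((hdiff _ (hmem y hy σ (Ioo_subset_Icc_self hσ))).continuousAt).comp
          (f := fun z : ℝ × E => α (z.2, z.1)) (x := (σ, y)) h1
      obtain ⟨δ, hδ, hδs⟩ := eventually_nhds_iff_ball.1
        ((h2.eventually (closedBall_mem_nhds _ hθ)).and
          (eventually_mem_set.2 (prod_mem_nhds hI (hVopen.mem_nhds hy))))
      filter_upwards [ball_mem_nhds (σ, y) hδ] with z hz
      rw [← ball_prod_same] at hz
      have hs : ∀ s ∈ ball σ δ, (s, z.2) ∈ ball (σ, y) δ := fun s hs => by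
        rw [← ball_prod_same]; exact ⟨hs, hz.2⟩
      refine (convex_ball σ δ).norm_image_sub_le_of_norm_hasFDerivWithin_le'
        (f := fun s => α (z.2, s))
        (f' := fun s => ContinuousLinearMap.toSpanSingleton ℝ (Y (α (z.2, s))))
        (fun s hs' => ?_) (fun s hs' => ?_) (mem_ball_self hδ) hz.1
      · have h3 := (hδs _ (hs s hs')).2
        exact ((hder z.2 h3.2 s (Ioo_subset_Icc_self h3.1)).hasFDerivAt).hasFDerivWithinAt
      · have h3 := (hδs _ (hs s hs')).1
        rw [dist_eq_norm] at h3
        refine ContinuousLinearMap.opNorm_le_bound _ hθ.le fun r => ?_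
        rw [sub_apply, ContinuousLinearMap.toSpanSingleton_apply,
          ContinuousLinearMap.toSpanSingleton_apply, ← smul_sub, norm_smul, mul_comm]
        gcongr
    have hsp := ((hasFDerivAt_iff_isLittleO.1 (hfd y hy σ hσ)).comp_tendsto
      (continuous_snd.tendsto (σ, y))).trans_isBigO
      (show _ =O[𝓝 (σ, y)] fun z : ℝ × E => z - (σ, y) from
        Asymptotics.isBigO_of_le _ fun z => by simp [Function.comp, Prod.norm_def])
    have htime' := htime.trans_isBigO
      (show _ =O[𝓝 (σ, y)] fun z : ℝ × E => z - (σ, y) from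
        Asymptotics.isBigO_of_le _ fun z => by simp [Prod.norm_def])
    refine (htime'.add hsp).congr_left fun z => ?_
    simp only [uncurry, Function.comp, ContinuousLinearMap.coprod_apply, Prod.fst_sub, Prod.snd_sub]
    abel
  · intro y hy σ hσ
    have h0 : (0 : ℝ) ∈ Ioo (-ε) ε := ⟨by linarith, hε⟩
    -- Both `D s y (Y y)` and `Y (Φ s y)` solve the linearised equation along the trajectory, with
    -- initial value `Y y`.
    refine ODE_solution_unique_of_mem_Ioo (f := fun s => D y s (Y y))
      (g := fun s => Y (α (y, s))) (v := fun s z => fderiv ℝ Y (α (y, s)) z) (s := fun _ => univ)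
      (K := K) (fun s hs => ?_) h0 (fun s hs => ⟨?_, mem_univ _⟩) (fun s hs => ⟨?_, mem_univ _⟩)
      ?_ hσ
    · exact ((fderiv ℝ Y (α (y, s))).lipschitz.weaken (by
        have := hbd _ (hmem y hy s (Ioo_subset_Icc_self hs))
        exact_mod_cast this)).lipschitzOnWith
    · exact ((hD y hy s hs).clm_apply (hasDerivAt_const s (Y y))).congr_deriv (by simp)
    · exact (hdiff _ (hmem y hy s (Ioo_subset_Icc_self hs))).hasFDerivAt.comp_hasDerivAt s
        (hder y hy s (Ioo_subset_Icc_self hs))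
    · simp [hD0 y hy, hzero y hy]
  · intro y hy
    -- A bound independent of the base point `y'` yields joint continuity at time `0`, where `D` is
    -- the identity for every base point.
    have hbound : ∀ y' ∈ V, ∀ s ∈ Ioo (-ε) ε, ‖D y' s - 1‖ ≤ Real.exp (K * |s|) - 1 := by
      intro y' hy' s hs
      rcases le_total 0 s with h0 | h0
      · have hsub : ∀ u ∈ Icc 0 s, u ∈ Ioo (-ε) ε := fun u hu =>
          ⟨by linarith [hu.1], by linarith [hu.2, hs.2]⟩
        rw [abs_of_nonneg h0]
        exact norm_sub_one_le_of_linear hK h0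
          (fun u hu => hbd _ (hmem y' hy' u (Ioo_subset_Icc_self (hsub u hu))))
          (fun u hu => hD y' hy' u (hsub u hu)) (hD0 y' hy')
      · have hsub : ∀ u ∈ Icc 0 (-s), -u ∈ Ioo (-ε) ε := fun u hu =>
          ⟨by linarith [hu.2, hs.1], by linarith [hu.1]⟩
        have := norm_sub_one_le_of_linear hK (neg_nonneg.2 h0)
          (A := fun u => -fderiv ℝ Y (α (y', -u))) (D := fun u => D y' (-u))
          (fun u hu => by
            rw [norm_neg]; exact hbd _ (hmem y' hy' _ (Ioo_subset_Icc_self (hsub u hu))))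
          (fun u hu => ((hD y' hy' _ (hsub u hu)).scomp u (hasDerivAt_neg u)).congr_deriv
            (by ext; simp)) (by simpa using hD0 y' hy')
        rw [abs_of_nonpos h0]
        simpa using this
    have hlim : Tendsto (fun z : ℝ × E => Real.exp (K * |z.1|) - 1) (𝓝 (0, y)) (𝓝 0) := by
      have : Continuous fun z : ℝ × E => Real.exp (K * |z.1|) - 1 := by fun_prop
      simpa using this.tendsto (0, y)
    rw [ContinuousAt, tendsto_iff_norm_sub_tendsto_zero]
    refine squeeze_zero' (Eventually.of_forall fun _ => norm_nonneg _) ?_ hlim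
    have h0 : (0 : ℝ) ∈ Ioo (-ε) ε := ⟨by linarith, hε⟩
    filter_upwards [prod_mem_nhds (isOpen_Ioo.mem_nhds h0) (hVopen.mem_nhds hy)] with z hz
    simpa [uncurry, hD0 y hy] using hbound z.2 hz.2 z.1 hz.1
  · intro c a b hab hlt hcV hc
    have hsub : ∀ u ∈ Icc a b, u - a ∈ Icc (-ε) ε := fun u hu =>
      ⟨by linarith [hu.1], by linarith [hu.2]⟩
    have ha : a ∈ Icc a b := ⟨le_rfl, hab⟩
    have hf : ∀ u ∈ Icc a b, HasDerivAt (fun u => α (c a, u - a)) (Y (α (c a, u - a))) u :=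
      fun u hu => (hder _ (hcV a ha) _ (hsub u hu)).comp_sub_const u a
    exact ODE_solution_unique_of_mem_Icc_right (v := fun _ => Y) (s := fun _ => ball y₀ R)
      (fun _ _ => hlip) (fun u hu => (hf u hu).continuousAt.continuousWithinAt)
      (fun u hu => (hf u (Ico_subset_Icc_self hu)).hasDerivWithinAt)
      (fun u hu => hmem _ (hcV a ha) _ (hsub u (Ico_subset_Icc_self hu)))
      (fun u hu => (hc u hu).continuousWithinAt)
      (fun u hu => (hc u (Ico_subset_Icc_self hu)).mono_of_mem_nhdsWithin
        (Icc_mem_nhdsGE_of_mem hu))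
      (fun u hu => hVB (hcV u (Ico_subset_Icc_self hu))) (by simp [hzero _ (hcV a ha)])
      ⟨hab, le_rfl⟩
  · intro c a b hab hlt hcV hc
    have hsub : ∀ u ∈ Icc a b, u - b ∈ Icc (-ε) ε := fun u hu =>
      ⟨by linarith [hu.1], by linarith [hu.2]⟩
    have hb : b ∈ Icc a b := ⟨hab, le_rfl⟩
    have hf : ∀ u ∈ Icc a b, HasDerivAt (fun u => α (c b, u - b)) (Y (α (c b, u - b))) u :=
      fun u hu => (hder _ (hcV b hb) _ (hsub u hu)).comp_sub_const u b
    exact ODE_solution_unique_of_mem_Icc_left (v := fun _ => Y) (s := fun _ => ball y₀ R)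
      (fun _ _ => hlip) (fun u hu => (hf u hu).continuousAt.continuousWithinAt)
      (fun u hu => (hf u (Ioc_subset_Icc_self hu)).hasDerivWithinAt)
      (fun u hu => hmem _ (hcV b hb) _ (hsub u (Ioc_subset_Icc_self hu)))
      (fun u hu => (hc u hu).continuousWithinAt)
      (fun u hu => (hc u (Ioc_subset_Icc_self hu)).mono_of_mem_nhdsWithin
        (Icc_mem_nhdsLE_of_mem hu))
      (fun u hu => hVB (hcV u (Ioc_subset_Icc_self hu))) (by simp [hzero _ (hcV b hb)])
      ⟨le_rfl, hab⟩

end LocalFlowExistence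

/-! ### The Lie derivative in coordinates -/

section LieCalculus

open Set Filter Function
open ContinuousAlternatingMap (curryLeft)

variable {E : Type*} [NormedAddCommGroup E] [NormedSpace ℝ E] {k : ℕ}

/-- The Lie derivative of a differential form on a normed space, given by Cartan's formula. -/
noncomputable def lieDerivE (a : E → E [⋀^Fin (k + 1)]→L[ℝ] ℝ) (Y : E → E) (y : E) :
    E [⋀^Fin (k + 1)]→L[ℝ] ℝ :=
  extDeriv (fun z => (a z).curryLeft (Y z)) y + (extDeriv a y).curryLeft (Y y)

theorem differentiableAt_curryLeft {a : E → E [⋀^Fin (k + 1)]→L[ℝ] ℝ} {Y : E → E} {y : E}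
    (ha : DifferentiableAt ℝ a y) (hY : DifferentiableAt ℝ Y y) :
    DifferentiableAt ℝ (fun z => (a z).curryLeft (Y z)) y := by
  have hL : Differentiable ℝ
      (fun f : E [⋀^Fin (k + 1)]→L[ℝ] ℝ => f.curryLeft) :=
    (ContinuousAlternatingMap.curryLeftLI (𝕜 := ℝ) (E := E) (F := ℝ)
      (n := k)).toContinuousLinearMap.differentiable
  have h1 : DifferentiableAt ℝ (fun z => (a z).curryLeft) y :=
    DifferentiableAt.comp (g := fun f : E [⋀^Fin (k + 1)]→L[ℝ] ℝ => f.curryLeft) (f := a) y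
      (hL (a y)) ha
  exact h1.clm_apply hY

theorem fderiv_curryLeft_apply {a : E → E [⋀^Fin (k + 1)]→L[ℝ] ℝ} {Y : E → E} {y : E}
    (ha : DifferentiableAt ℝ a y) (hY : DifferentiableAt ℝ Y y) (w : Fin k → E) (u : E) :
    fderiv ℝ (fun z => (a z).curryLeft (Y z) w) y u =
      fderiv ℝ a y u (Matrix.vecCons (Y y) w) + a y (Matrix.vecCons (fderiv ℝ Y y u) w) := by
  have h := fderiv_continuousAlternatingMap_apply_apply (f := a) (x := y)
    (g := fun i z => (Matrix.vecCons (Y z) w : Fin (k + 1) → E) i) ha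
    (fun i => by
      refine Fin.cases ?_ (fun j => ?_) i
      · simpa using hY
      · simp) u
  refine h.trans ?_
  rw [Fin.sum_univ_succ]
  -- The slots holding the constant vectors `w` have zero derivative, so their terms in the product
  -- rule drop out.
  have h0 : ∀ j : Fin k, a y (update (Matrix.vecCons (Y y) w) j.succ 0) = 0 := fun j =>
    (a y).map_coord_zero j.succ (by simp)
  simp [h0]
  congr 1
  ext i
  refine Fin.cases ?_ (fun j => ?_) i <;> simp [update]

/-- In Cartan's formula the terms that differentiate `a` in the directions `v i` occur in both
summands with opposite signs and cancel. What remains is exactly the expression produced by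
differentiating `a` along a flow and its linearisation. -/
theorem lieDerivE_apply {a : E → E [⋀^Fin (k + 1)]→L[ℝ] ℝ} {Y : E → E} {y : E}
    (ha : DifferentiableAt ℝ a y) (hY : DifferentiableAt ℝ Y y) (v : Fin (k + 1) → E) :
    lieDerivE a Y y v =
      fderiv ℝ a y (Y y) v + ∑ i, a y (update v i (fderiv ℝ Y y (v i))) := by
  have h1 := extDeriv_apply (differentiableAt_curryLeft ha hY) v
  have h2 := extDeriv_apply ha (Matrix.vecCons (Y y) v)
  rw [lieDerivE, ContinuousAlternatingMap.add_apply,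
    ContinuousAlternatingMap.curryLeft_apply_apply, h1, h2, Fin.sum_univ_succ (n := k + 1)]
  have h3 : ∀ (u w), fderiv ℝ (fun z => a z w) y u = fderiv ℝ a y u w := fun u w =>
    fderiv_continuousAlternatingMap_apply_const_apply ha w u
  simp only [fderiv_curryLeft_apply ha hY, h3]
  have h4 : ∀ i : Fin (k + 1), a y (update v i (fderiv ℝ Y y (v i))) =
      (-1) ^ (i : ℕ) • a y (Matrix.vecCons (fderiv ℝ Y y (v i)) (i.removeNth v)) := by
    intro i
    rw [← Fin.insertNth_removeNth, ContinuousAlternatingMap.map_insertNth]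
  have h5 : ∀ i : Fin (k + 1), (i.succ.removeNth (Matrix.vecCons (Y y) v) : Fin (k + 1) → E) =
      Matrix.vecCons (Y y) (i.removeNth v) := by
    intro i
    ext j
    refine Fin.cases ?_ (fun j => ?_) j <;> simp [Fin.removeNth]
  have h6 : ((0 : Fin (k + 2)).removeNth (Matrix.vecCons (Y y) v) : Fin (k + 1) → E) = v := by
    ext j; simp [Fin.removeNth]
  simp only [h4, h5, h6, smul_add, Finset.sum_add_distrib, Matrix.cons_val_zero,
    Matrix.cons_val_succ, Fin.val_zero, pow_zero, one_smul, Fin.val_succ, pow_succ, mul_neg,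
    mul_one, neg_smul, Finset.sum_neg_distrib]
  abel

/-- The product rule for the Lie derivative. -/
theorem lieDerivE_smul {a : E → E [⋀^Fin (k + 1)]→L[ℝ] ℝ} {Y : E → E} {h : E → ℝ} {y : E}
    (ha : DifferentiableAt ℝ a y) (hY : DifferentiableAt ℝ Y y) (hh : DifferentiableAt ℝ h y) :
    lieDerivE (fun z => h z • a z) Y y = fderiv ℝ h y (Y y) • a y + h y • lieDerivE a Y y := by
  ext v
  rw [lieDerivE_apply (hh.fun_smul ha) hY, ContinuousAlternatingMap.add_apply,
    ContinuousAlternatingMap.smul_apply, ContinuousAlternatingMap.smul_apply,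
    lieDerivE_apply ha hY, fderiv_fun_smul hh ha]
  simp only [add_apply, smul_apply, ContinuousLinearMap.smulRight_apply,
    ContinuousAlternatingMap.add_apply, ContinuousAlternatingMap.smul_apply, smul_eq_mul,
    mul_add, Finset.mul_sum]
  ring

/-- The Lie derivative commutes with pullbacks. -/
theorem lieDerivE_pullback {a b : E → E [⋀^Fin (k + 1)]→L[ℝ] ℝ} {Y Y' : E → E} {Θ : E → E} {y : E}
    (ha : DifferentiableAt ℝ a (Θ y)) (hY : DifferentiableAt ℝ Y (Θ y))
    (hΘ : ContDiffAt ℝ 2 Θ y)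
    (hb : ∀ᶠ z in 𝓝 y, b z = (a (Θ z)).compContinuousLinearMap (fderiv ℝ Θ z))
    (hY' : ∀ᶠ z in 𝓝 y, fderiv ℝ Θ z (Y' z) = Y (Θ z)) :
    lieDerivE b Y' y = (lieDerivE a Y (Θ y)).compContinuousLinearMap (fderiv ℝ Θ y) := by
  have hr : minSmoothness ℝ 2 ≤ 2 := by simp
  -- Cartan's formula is built from exterior derivatives and contractions, each of which is natural;
  -- `C²` regularity of `Θ` is what the exterior derivative requires.
  have h1 : extDeriv b y = (extDeriv a (Θ y)).compContinuousLinearMap (fderiv ℝ Θ y) := by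
    rw [← extDeriv_pullback ha hΘ hr]
    exact EventuallyEq.extDeriv_eq hb
  have h2 : extDeriv (fun z => (b z).curryLeft (Y' z)) y =
      (extDeriv (fun z => (a z).curryLeft (Y z)) (Θ y)).compContinuousLinearMap
        (fderiv ℝ Θ y) := by
    rw [← extDeriv_pullback (differentiableAt_curryLeft ha hY) hΘ hr]
    refine EventuallyEq.extDeriv_eq ?_
    filter_upwards [hb, hY'] with z hz hz'
    rw [hz, ContinuousAlternatingMap.curryLeft_compContinuousLinearMap, hz']
  rw [lieDerivE, h1, h2, ContinuousAlternatingMap.curryLeft_compContinuousLinearMap,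
    hY'.self_of_nhds]
  rfl

/-- A form with vanishing Lie derivative is invariant under the local flow. -/
theorem IsLocalFlow.form_apply_D {Y : E → E} {Ω V : Set E} {ε : ℝ} {Φ : ℝ → E → E}
    {D : ℝ → E → E →L[ℝ] E} (hF : IsLocalFlow Y Ω V ε Φ D) {a : E → E [⋀^Fin (k + 1)]→L[ℝ] ℝ}
    (ha : ∀ y ∈ Ω, DifferentiableAt ℝ a y) (hY : ∀ y ∈ Ω, DifferentiableAt ℝ Y y)
    (hlie : ∀ y ∈ Ω, lieDerivE a Y y = 0) {y : E} (hy : y ∈ V) {σ : ℝ} (hσ : σ ∈ Ioo (-ε) ε)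
    (v : Fin (k + 1) → E) : a (Φ σ y) (fun i => D σ y (v i)) = a y v := by
  have h0 : (0 : ℝ) ∈ Ioo (-ε) ε := ⟨by linarith [hF.pos], hF.pos⟩
  -- Since `D' = fderiv Y ∘ D`, the product rule gives the formula of `lieDerivE_apply` at the
  -- vectors `D s y (v i)`, which is zero.
  have hder : ∀ s ∈ Ioo (-ε) ε, HasDerivAt (fun s => a (Φ s y) (fun i => D s y (v i))) 0 s := by
    intro s hs
    have h1 : HasFDerivAt (fun s => a (Φ s y)) _ s :=
      (ha _ (hF.mem y hy s hs)).hasFDerivAt.comp s (hF.hasDerivAt y hy s hs).hasFDerivAt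
    have h2 : ∀ i, HasFDerivAt (fun s => D s y (v i)) _ s := fun i =>
      ((hF.hasDerivAt_D y hy s hs).clm_apply (hasDerivAt_const s (v i))).hasFDerivAt
    refine (h1.continuousAlternatingMap_apply h2).hasDerivAt.congr_deriv ?_
    have h3 := lieDerivE_apply (ha _ (hF.mem y hy s hs)) (hY _ (hF.mem y hy s hs))
      (fun i => D s y (v i))
    rw [hlie _ (hF.mem y hy s hs)] at h3
    simpa using h3.symm
  have := (convex_Ioo (-ε) ε).is_const_of_fderivWithin_eq_zero (𝕜 := ℝ)
    (f := fun s => a (Φ s y) (fun i => D s y (v i)))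
    (fun s hs => (hder s hs).differentiableAt.differentiableWithinAt)
    (fun s hs => by
      rw [fderivWithin_of_isOpen isOpen_Ioo hs, (hder s hs).hasFDerivAt.fderiv]
      ext; simp) hσ h0
  simpa [hF.map_zero y hy, hF.D_zero y hy] using this

end LieCalculus

/-! ### Flow boxes at a transverse hypersurface -/

section Transversal

open Set Filter Function

variable {E : Type*} [NormedAddCommGroup E] [NormedSpace ℝ E] [FiniteDimensional ℝ E]
  {F : Type*} [NormedAddCommGroup F] [NormedSpace ℝ F] [FiniteDimensional ℝ F]

/-- A vector transverse to a hypersurface complements a parametrisation of it to a linear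
isomorphism. -/
theorem exists_equiv_coprod_of_isCompl {L : F →L[ℝ] E} {v : E}
    (hdim : Module.finrank ℝ E = Module.finrank ℝ F + 1)
    (hc : IsCompl (LinearMap.range (L : F →ₗ[ℝ] E)) (Submodule.span ℝ {v})) :
    ∃ e : (ℝ × F) ≃L[ℝ] E,
      (e : ℝ × F →L[ℝ] E) = (ContinuousLinearMap.toSpanSingleton ℝ v).coprod L := by
  set T := (ContinuousLinearMap.toSpanSingleton ℝ v).coprod L with hT
  have hsurj : Surjective T.toLinearMap := by
    intro y
    have hy : y ∈ LinearMap.range (L : F →ₗ[ℝ] E) ⊔ Submodule.span ℝ {v} := by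
      rw [hc.sup_eq_top]; trivial
    obtain ⟨_, ⟨x, rfl⟩, _, hz, rfl⟩ := Submodule.mem_sup.1 hy
    obtain ⟨c, rfl⟩ := Submodule.mem_span_singleton.1 hz
    exact ⟨(c, x), by simp [hT, add_comm]⟩
  have hfr : Module.finrank ℝ (ℝ × F) = Module.finrank ℝ E := by
    rw [Module.finrank_prod, Module.finrank_self, hdim, add_comm]
  have hinj : Injective T.toLinearMap :=
    (LinearMap.injective_iff_surjective_of_finrank_eq_finrank hfr).2 hsurj
  refine ⟨(LinearEquiv.ofBijective T.toLinearMap ⟨hinj, hsurj⟩).toContinuousLinearEquiv, ?_⟩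
  ext z <;> rfl

/-- Flow-box coordinates around a point of a hypersurface transverse to the vector field. -/
theorem IsLocalFlow.exists_flowBox [CompleteSpace E] {Y : E → E} {Ω V : Set E} {ε : ℝ}
    {Φ : ℝ → E → E} {D : ℝ → E → E →L[ℝ] E} (hF : IsLocalFlow Y Ω V ε Φ D) {j : F → E} {w₀ : F}
    (hj : ContDiffAt ℝ 1 j w₀) (hw₀ : j w₀ ∈ V) {O : Set F} (hO : O ∈ 𝓝 w₀)
    (hdim : Module.finrank ℝ E = Module.finrank ℝ F + 1)
    (hc : IsCompl (LinearMap.range (fderiv ℝ j w₀ : F →ₗ[ℝ] E)) (Submodule.span ℝ {Y (j w₀)})) :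
    ∃ Q : OpenPartialHomeomorph (ℝ × F) E, (0, w₀) ∈ Q.source ∧ ∀ z ∈ Q.source,
      z.1 ∈ Ioo (-ε) ε ∧ z.2 ∈ O ∧ j z.2 ∈ V ∧ Q z = Φ z.1 (j z.2) ∧ DifferentiableAt ℝ j z.2 ∧
      ∃ Q' : (ℝ × F) ≃L[ℝ] E,
        (Q' : ℝ × F →L[ℝ] E) = (ContinuousLinearMap.toSpanSingleton ℝ (Y (Φ z.1 (j z.2)))).coprod
          (D z.1 (j z.2) ∘L fderiv ℝ j z.2) ∧
        HasFDerivAt Q.symm (Q'.symm : E →L[ℝ] ℝ × F) (Q z) := by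
  have h0 : (0 : ℝ) ∈ Ioo (-ε) ε := ⟨by linarith [hF.pos], hF.pos⟩
  set f₁ : ℝ → F → ℝ →L[ℝ] E :=
    fun σ w => ContinuousLinearMap.toSpanSingleton ℝ (Y (Φ σ (j w))) with hf₁
  set f₂ : ℝ → F → F →L[ℝ] E := fun σ w => D σ (j w) ∘L fderiv ℝ j w with hf₂
  set Ψ : ℝ → F → E := fun σ w => Φ σ (j w) with hΨ
  have hgood : ∀ᶠ z : ℝ × F in 𝓝 (0, w₀),
      z.1 ∈ Ioo (-ε) ε ∧ z.2 ∈ O ∧ j z.2 ∈ V ∧ DifferentiableAt ℝ j z.2 := by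
    have h1 : ∀ᶠ w in 𝓝 w₀, ContDiffAt ℝ 1 j w := hj.eventually (by simp)
    have h2 : ∀ᶠ w in 𝓝 w₀, j w ∈ V := hj.continuousAt.eventually_mem (hF.isOpen.mem_nhds hw₀)
    rw [nhds_prod_eq]
    filter_upwards [(eventually_mem_set.2 (isOpen_Ioo.mem_nhds h0)).prod_mk
      ((h1.and h2).and (eventually_mem_set.2 hO))] with z hz
    exact ⟨hz.1, hz.2.2, hz.2.1.2, hz.2.1.1.differentiableAt (by norm_num)⟩
  have hjc : ContinuousAt (fun z : ℝ × F => (z.1, j z.2)) (0, w₀) :=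
    continuousAt_fst.prodMk
      (ContinuousAt.comp (g := j) (f := Prod.snd) (x := ((0 : ℝ), w₀)) hj.continuousAt
        continuousAt_snd)
  have hΨc : ContinuousAt ↿Ψ (0, w₀) :=
    ContinuousAt.comp (g := uncurry Φ) (f := fun z : ℝ × F => (z.1, j z.2)) (x := ((0 : ℝ), w₀))
      (hF.hasFDerivAt _ hw₀ _ h0).continuousAt hjc
  have hc₁ : ContinuousAt ↿f₁ (0, w₀) := by
    have h1 : ContinuousAt (fun z : ℝ × F => Y (Ψ z.1 z.2)) (0, w₀) :=
      ContinuousAt.comp (g := Y) (f := ↿Ψ) (x := ((0 : ℝ), w₀))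
        (hF.continuousAt_field _ (hF.mem _ hw₀ _ h0)) hΨc
    exact (ContinuousLinearMap.toSpanSingletonCLE (𝕜 := ℝ) (E := E)).continuous.continuousAt.comp
      (f := fun z : ℝ × F => Y (Ψ z.1 z.2)) h1
  have hc₂ : ContinuousAt ↿f₂ (0, w₀) := by
    have h1 : ContinuousAt (fun z : ℝ × F => D z.1 (j z.2)) (0, w₀) :=
      ContinuousAt.comp (g := uncurry D) (f := fun z : ℝ × F => (z.1, j z.2)) (x := ((0 : ℝ), w₀))
        (hF.continuousAt_D _ hw₀) hjc
    have h2 : ContinuousAt (fun z : ℝ × F => fderiv ℝ j z.2) (0, w₀) :=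
      ContinuousAt.comp (g := fderiv ℝ j) (f := Prod.snd) (x := ((0 : ℝ), w₀))
        (hj.fderiv_right (m := 0) (by norm_num)).continuousAt continuousAt_snd
    exact h1.clm_comp h2
  have hd₁ : ∀ᶠ z : ℝ × F in 𝓝 (0, w₀), HasFDerivAt (Ψ · z.2) (↿f₁ z) z.1 := by
    filter_upwards [hgood] with z hz
    exact (hF.hasDerivAt _ hz.2.2.1 _ hz.1).hasFDerivAt
  have hd₂ : ∀ᶠ z : ℝ × F in 𝓝 (0, w₀), HasFDerivAt (Ψ z.1 ·) (↿f₂ z) z.2 := by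
    filter_upwards [hgood] with z hz
    exact (hF.hasFDerivAt_space _ hz.2.2.1 _ hz.1).comp z.2 hz.2.2.2.hasFDerivAt
  -- Partial derivatives that exist nearby and are continuous at the base point give strict
  -- differentiability there, enough for the inverse function theorem. At time `0`, where `D = 1`,
  -- the derivative is invertible by transversality.
  have hstrict := hasStrictFDerivAt_uncurry_coprod hd₁ hd₂ hc₁ hc₂
  obtain ⟨e, he⟩ := exists_equiv_coprod_of_isCompl (L := fderiv ℝ j w₀) (v := Y (j w₀)) hdim hc
  have he' : (e : ℝ × F →L[ℝ] E) = (↿f₁ ((0 : ℝ), w₀)).coprod (↿f₂ ((0 : ℝ), w₀)) := by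
    rw [he]
    change _ = (ContinuousLinearMap.toSpanSingleton ℝ (Y (Φ 0 (j w₀)))).coprod
      (D 0 (j w₀) ∘L fderiv ℝ j w₀)
    rw [hF.map_zero _ hw₀, hF.D_zero _ hw₀]
    rfl
  rw [← he'] at hstrict
  -- Invertible operators form an open set and the partial derivatives are continuous at the base
  -- point, so the derivative stays invertible nearby.
  have hinv : ∀ᶠ z : ℝ × F in 𝓝 (0, w₀), ∃ Q' : (ℝ × F) ≃L[ℝ] E,
      (Q' : ℝ × F →L[ℝ] E) = (↿f₁ z).coprod (↿f₂ z) := by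
    have h1 : ContinuousAt (fun z : ℝ × F => (↿f₁ z).coprod (↿f₂ z)) (0, w₀) := by
      have h2 : ∀ z : ℝ × F, (↿f₁ z).coprod (↿f₂ z) =
          (↿f₁ z) ∘L (ContinuousLinearMap.fst ℝ ℝ F) + (↿f₂ z) ∘L (ContinuousLinearMap.snd ℝ ℝ F) :=
        fun z => by ext <;> simp
      simp only [h2]
      exact (hc₁.clm_comp continuousAt_const).add (hc₂.clm_comp continuousAt_const)
    exact h1.eventually_mem (s := range ((↑) : ((ℝ × F) ≃L[ℝ] E) → (ℝ × F →L[ℝ] E)))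
      (by simp only [← he']; exact e.nhds)
  obtain ⟨O', hO', hO'open, h0O'⟩ := eventually_nhds_iff.1 (hgood.and hinv)
  set Q₀ := hstrict.toOpenPartialHomeomorph (↿Ψ) with hQ₀
  refine ⟨Q₀.restrOpen O' hO'open, ⟨hstrict.mem_toOpenPartialHomeomorph_source, h0O'⟩,
    fun z hz => ?_⟩
  obtain ⟨⟨hz1, hzO, hz2, hz3⟩, Q', hQ'⟩ := hO' z hz.2
  refine ⟨hz1, hzO, hz2, rfl, hz3, Q', hQ', ?_⟩
  have hmem : Q₀ z ∈ Q₀.target := Q₀.map_source hz.1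
  have hleft : Q₀.symm (Q₀ z) = z := Q₀.left_inv hz.1
  refine Q₀.hasFDerivAt_symm hmem ?_
  change HasFDerivAt Q₀ (Q' : ℝ × F →L[ℝ] E) (Q₀.symm (Q₀ z))
  rw [hleft]
  have hjz : HasFDerivAt (fun z : ℝ × F => (z.1, j z.2))
      ((ContinuousLinearMap.fst ℝ ℝ F).prod (fderiv ℝ j z.2 ∘L ContinuousLinearMap.snd ℝ ℝ F)) z :=
    hasFDerivAt_fst.prodMk (hz3.hasFDerivAt.comp z hasFDerivAt_snd)
  have := HasFDerivAt.comp (g := uncurry Φ) z (hF.hasFDerivAt _ hz2 _ hz1) hjz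
  refine this.congr_fderiv ?_
  rw [hQ']
  ext <;> simp [f₁, f₂, HasUncurry.uncurry]

end Transversal

/-! ### Forms and vector fields in charts -/

section Charts

open Set Filter Function

variable {d k : ℕ} {M : Type*} [TopologicalSpace M] [ChartedSpace (Eucl d) M]
  [IsManifold (𝓡 d) ∞ M]

/-- The covector `α x`, on the model space. -/
noncomputable def formAt (α : DiffForm d k M) (x : M) : Eucl d [⋀^Fin k]→L[ℝ] ℝ := α x

/-- The tangent vector `X x`, in the model space. -/
def fieldAt (X : ∀ x : M, TangentSpace (𝓡 d) x) (x : M) : Eucl d := X x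

/-- The derivative of the preferred chart at `x₀`, as a map of the model space. -/
noncomputable def chartDeriv (x₀ x : M) : Eucl d →L[ℝ] Eucl d :=
  mfderiv (𝓡 d) 𝓘(ℝ, Eucl d) (extChartAt (𝓡 d) x₀) x

/-- The derivative of the inverse of the preferred chart at `x₀`, as a map of the model space. -/
noncomputable def chartSymmDeriv (x₀ : M) (y : Eucl d) : Eucl d →L[ℝ] Eucl d :=
  mfderiv 𝓘(ℝ, Eucl d) (𝓡 d) (extChartAt (𝓡 d) x₀).symm y

theorem mdifferentiableAt_chart {x₀ x : M} (hx : x ∈ (extChartAt (𝓡 d) x₀).source) :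
    MDifferentiableAt (𝓡 d) 𝓘(ℝ, Eucl d) (extChartAt (𝓡 d) x₀) x :=
  mdifferentiableAt_extChartAt (by rwa [extChartAt_source] at hx)

theorem contMDiffAt_chart_symm {x₀ : M} {y : Eucl d} (hy : y ∈ (extChartAt (𝓡 d) x₀).target) :
    ContMDiffAt 𝓘(ℝ, Eucl d) (𝓡 d) ∞ (extChartAt (𝓡 d) x₀).symm y :=
  (contMDiffOn_extChartAt_symm x₀).contMDiffAt ((isOpen_extChartAt_target x₀).mem_nhds hy)

theorem mdifferentiableAt_chart_symm {x₀ : M} {y : Eucl d}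
    (hy : y ∈ (extChartAt (𝓡 d) x₀).target) :
    MDifferentiableAt 𝓘(ℝ, Eucl d) (𝓡 d) (extChartAt (𝓡 d) x₀).symm y :=
  (contMDiffAt_chart_symm hy).mdifferentiableAt (by simp)

theorem chartSymmDeriv_isInvertible {x₀ : M} {y : Eucl d}
    (hy : y ∈ (extChartAt (𝓡 d) x₀).target) : (chartSymmDeriv x₀ y).IsInvertible := by
  have := isInvertible_mfderivWithin_extChartAt_symm (I := 𝓡 d) hy
  rwa [ModelWithCorners.range_eq_univ, mfderivWithin_univ] at this

theorem chartDeriv_chartSymmDeriv {x₀ : M} {y : Eucl d} (hy : y ∈ (extChartAt (𝓡 d) x₀).target)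
    (v : Eucl d) : chartDeriv x₀ ((extChartAt (𝓡 d) x₀).symm y) (chartSymmDeriv x₀ y v) = v := by
  have := mfderiv_extChartAt_comp_mfderivWithin_extChartAt_symm (I := 𝓡 d) hy
  rw [ModelWithCorners.range_eq_univ, mfderivWithin_univ] at this
  exact congrArg (fun L : Eucl d →L[ℝ] Eucl d => L v) this

theorem chartSymmDeriv_chartDeriv {x₀ x : M} (hx : x ∈ (extChartAt (𝓡 d) x₀).source)
    (v : Eucl d) : chartSymmDeriv x₀ (extChartAt (𝓡 d) x₀ x) (chartDeriv x₀ x v) = v := by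
  have := mfderivWithin_extChartAt_symm_comp_mfderiv_extChartAt' (I := 𝓡 d) hx
  rw [ModelWithCorners.range_eq_univ, mfderivWithin_univ] at this
  exact congrArg (fun L : Eucl d →L[ℝ] Eucl d => L v) this

/-- `VectorField.mpullback` applies `inverse` to the derivative, and on the chart target this is a
genuine inverse. -/
theorem chartSymmDeriv_fieldInChart (X : ∀ x : M, TangentSpace (𝓡 d) x) {x₀ : M} {y : Eucl d}
    (hy : y ∈ (extChartAt (𝓡 d) x₀).target) :
    chartSymmDeriv x₀ y (fieldInChart X x₀ y) = fieldAt X ((extChartAt (𝓡 d) x₀).symm y) :=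
  ((chartSymmDeriv_isInvertible hy).inverse_apply_eq (x := fieldInChart X x₀ y)
    (y := fieldAt X ((extChartAt (𝓡 d) x₀).symm y)).1 rfl).symm

theorem fieldInChart_apply (X : ∀ x : M, TangentSpace (𝓡 d) x) {x₀ x : M}
    (hx : x ∈ (extChartAt (𝓡 d) x₀).source) :
    fieldInChart X x₀ (extChartAt (𝓡 d) x₀ x) = chartDeriv x₀ x (fieldAt X x) := by
  have hy := (extChartAt (𝓡 d) x₀).map_source hx
  have h1 := chartDeriv_chartSymmDeriv hy (fieldInChart X x₀ (extChartAt (𝓡 d) x₀ x))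
  rw [chartSymmDeriv_fieldInChart X hy, (extChartAt (𝓡 d) x₀).left_inv hx] at h1
  exact h1.symm

theorem contDiffAt_fieldInChart {X : ∀ x : M, TangentSpace (𝓡 d) x}
    (hX : ContMDiff (𝓡 d) (𝓡 d).tangent ∞ (fun x => (⟨x, X x⟩ : TangentBundle (𝓡 d) M)))
    {x₀ : M} {y : Eucl d} (hy : y ∈ (extChartAt (𝓡 d) x₀).target) :
    ContDiffAt ℝ ∞ (fieldInChart X x₀) y :=
  contMDiffAt_vectorSpace_iff_contDiffAt.1
    (ContMDiffAt.mpullback_vectorField_preimage (n := ∞) (hX _) (contMDiffAt_chart_symm hy)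
      (chartSymmDeriv_isInvertible hy) (by simp))

omit [IsManifold (𝓡 d) ∞ M] in
theorem IsSmoothForm.contDiffAt {α : DiffForm d k M} (hα : IsSmoothForm α) {x₀ : M} {y : Eucl d}
    (hy : y ∈ (extChartAt (𝓡 d) x₀).target) : ContDiffAt ℝ ∞ (formInChart α x₀) y :=
  (hα x₀).contDiffAt ((isOpen_extChartAt_target x₀).mem_nhds hy)

/-- The coordinate change between two preferred charts. -/
noncomputable def chartChange (x₀ x₁ : M) : Eucl d → Eucl d :=
  extChartAt (𝓡 d) x₁ ∘ (extChartAt (𝓡 d) x₀).symm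

theorem contDiffAt_chartChange {x₀ x₁ : M} {y : Eucl d}
    (hy : y ∈ (extChartAt (𝓡 d) x₀).target)
    (hy' : (extChartAt (𝓡 d) x₀).symm y ∈ (extChartAt (𝓡 d) x₁).source) :
    ContDiffAt ℝ ∞ (chartChange x₀ x₁) y :=
  ((contMDiffAt_extChartAt' (by rwa [extChartAt_source] at hy')).comp y
    (contMDiffAt_chart_symm hy)).contDiffAt

theorem fderiv_chartChange {x₀ x₁ : M} {y : Eucl d}
    (hy : y ∈ (extChartAt (𝓡 d) x₀).target)
    (hy' : (extChartAt (𝓡 d) x₀).symm y ∈ (extChartAt (𝓡 d) x₁).source) :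
    fderiv ℝ (chartChange x₀ x₁) y =
      chartDeriv x₁ ((extChartAt (𝓡 d) x₀).symm y) ∘L chartSymmDeriv x₀ y := by
  have h := mfderiv_comp (I := 𝓘(ℝ, Eucl d)) (I'' := 𝓘(ℝ, Eucl d)) y (mdifferentiableAt_chart hy')
    (mdifferentiableAt_chart_symm hy)
  rw [mfderiv_eq_fderiv] at h
  exact h

omit [IsManifold (𝓡 d) ∞ M] in
theorem formInChart_eq (α : DiffForm d k M) (x₀ : M) (y : Eucl d) :
    formInChart α x₀ y = (formAt α ((extChartAt (𝓡 d) x₀).symm y)).compContinuousLinearMap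
      (chartSymmDeriv x₀ y) :=
  rfl

theorem formInChart_chart_comp (α : DiffForm d k M) {x₀ x : M}
    (hx : x ∈ (extChartAt (𝓡 d) x₀).source) :
    (formInChart α x₀ (extChartAt (𝓡 d) x₀ x)).compContinuousLinearMap (chartDeriv x₀ x) =
      formAt α x := by
  ext v
  simp only [formInChart_eq, ContinuousAlternatingMap.compContinuousLinearMap_apply, comp_def,
    chartSymmDeriv_chartDeriv hx, (extChartAt (𝓡 d) x₀).left_inv hx]

theorem formInChart_chart_apply (α : DiffForm d k M) {x₀ x : M}
    (hx : x ∈ (extChartAt (𝓡 d) x₀).source) (v : Fin k → Eucl d) :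
    formInChart α x₀ (extChartAt (𝓡 d) x₀ x) (fun i => chartDeriv x₀ x (v i)) = formAt α x v := by
  rw [← formInChart_chart_comp α hx]
  rfl

/-- Together with `fderiv_chartChange_fieldInChart`, this puts a change of charts into the shape
required by `lieDerivE_pullback`. -/
theorem formInChart_chartChange (α : DiffForm d k M) {x₀ x₁ : M} {y : Eucl d}
    (hy : y ∈ (extChartAt (𝓡 d) x₀).target)
    (hy' : (extChartAt (𝓡 d) x₀).symm y ∈ (extChartAt (𝓡 d) x₁).source) :
    formInChart α x₀ y = (formInChart α x₁ (chartChange x₀ x₁ y)).compContinuousLinearMap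
      (fderiv ℝ (chartChange x₀ x₁) y) := by
  rw [formInChart_eq, ← formInChart_chart_comp α hy', fderiv_chartChange hy hy']
  rfl

theorem fderiv_chartChange_fieldInChart (X : ∀ x : M, TangentSpace (𝓡 d) x) {x₀ x₁ : M}
    {y : Eucl d} (hy : y ∈ (extChartAt (𝓡 d) x₀).target)
    (hy' : (extChartAt (𝓡 d) x₀).symm y ∈ (extChartAt (𝓡 d) x₁).source) :
    fderiv ℝ (chartChange x₀ x₁) y (fieldInChart X x₀ y) =
      fieldInChart X x₁ (chartChange x₀ x₁ y) := by
  rw [fderiv_chartChange hy hy', ContinuousLinearMap.comp_apply, chartSymmDeriv_fieldInChart X hy,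
    ← fieldInChart_apply X hy']
  rfl

/-- If the Lie derivative of a form vanishes, it vanishes in all coordinate expressions. -/
theorem lieDerivE_formInChart_eq_zero {X : ∀ x : M, TangentSpace (𝓡 d) x}
    (hX : ContMDiff (𝓡 d) (𝓡 d).tangent ∞ (fun x => (⟨x, X x⟩ : TangentBundle (𝓡 d) M)))
    {α : DiffForm d (k + 1) M} (hα : IsSmoothForm α) (hL : ∀ x, lieDerivative X α x = 0)
    {x₀ : M} {y : Eucl d} (hy : y ∈ (extChartAt (𝓡 d) x₀).target) :
    lieDerivE (formInChart α x₀) (fieldInChart X x₀) y = 0 := by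
  -- `lieDerivative` is computed at `x` in the chart centred at `x`, so the chart at `x₀` is
  -- compared with that one near `y`.
  set x := (extChartAt (𝓡 d) x₀).symm y with hx
  have hxx : x ∈ (extChartAt (𝓡 d) x).source := mem_extChartAt_source x
  have hxt : extChartAt (𝓡 d) x x ∈ (extChartAt (𝓡 d) x).target := mem_extChartAt_target x
  have h1 : (lieDerivE (formInChart α x) (fieldInChart X x)
      (extChartAt (𝓡 d) x x)).compContinuousLinearMap (chartDeriv x x) = 0 := hL x
  have h0 : lieDerivE (formInChart α x) (fieldInChart X x) (extChartAt (𝓡 d) x x) = 0 := by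
    ext v
    have h3 : ∀ i, chartDeriv x x (chartSymmDeriv x (extChartAt (𝓡 d) x x) (v i)) = v i := by
      intro i
      have := chartDeriv_chartSymmDeriv hxt (v i)
      rwa [(extChartAt (𝓡 d) x).left_inv hxx] at this
    have h2 := congrArg (fun f : Eucl d [⋀^Fin (k + 1)]→L[ℝ] ℝ =>
      f (fun i => chartSymmDeriv x (extChartAt (𝓡 d) x x) (v i))) h1
    simp only [ContinuousAlternatingMap.compContinuousLinearMap_apply, comp_def, h3] at h2
    exact h2
  have hcs : chartChange x₀ x y = extChartAt (𝓡 d) x x := rfl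
  have hev : ∀ᶠ z in 𝓝 y, z ∈ (extChartAt (𝓡 d) x₀).target ∧
      (extChartAt (𝓡 d) x₀).symm z ∈ (extChartAt (𝓡 d) x).source :=
    (eventually_mem_set.2 ((isOpen_extChartAt_target x₀).mem_nhds hy)).and
      ((continuousAt_extChartAt_symm'' hy).eventually_mem
        ((isOpen_extChartAt_source x).mem_nhds hxx))
  rw [lieDerivE_pullback (a := formInChart α x) (Y := fieldInChart X x) (Θ := chartChange x₀ x)
    ((hα.contDiffAt hxt).differentiableAt (by simp))
    ((contDiffAt_fieldInChart hX hxt).differentiableAt (by simp))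
    ((contDiffAt_chartChange hy hxx).of_le (by norm_cast))
    (hev.mono fun z hz => formInChart_chartChange α hz.1 hz.2)
    (hev.mono fun z hz => fderiv_chartChange_fieldInChart X hz.1 hz.2), hcs, h0]
  rfl

end Charts

/-! ### Steps along the flow on the manifold -/

section ManifoldFlow

open Set Filter Function

variable {d k : ℕ} {M : Type*} [TopologicalSpace M] [ChartedSpace (Eucl d) M]

/-- Differentiability of vector-valued functions, read in the preferred chart. -/
theorem hasMFDerivAt_vector_iff {F : Type*} [NormedAddCommGroup F] [NormedSpace ℝ F] {f : M → F}
    {x : M} {L : Eucl d →L[ℝ] F} :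
    HasMFDerivAt (𝓡 d) 𝓘(ℝ, F) f x L ↔ ContinuousAt f x ∧
      HasFDerivAt (f ∘ (extChartAt (𝓡 d) x).symm) L (extChartAt (𝓡 d) x x) := by
  have h : HasFDerivWithinAt (f ∘ (extChartAt (𝓡 d) x).symm) L (range (𝓡 d))
      (extChartAt (𝓡 d) x x) ↔ HasFDerivAt (f ∘ (extChartAt (𝓡 d) x).symm) L
      (extChartAt (𝓡 d) x x) := by
    rw [ModelWithCorners.range_eq_univ, hasFDerivWithinAt_univ]
  exact and_congr Iff.rfl h

/-- The target carries the model `𝓘(ℝ, F × F')` of the vector space, not the product of two models,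
so that the result composes with Fréchet derivatives on `F × F'`. -/
theorem hasMFDerivAt_prodMk_vector {F F' : Type*} [NormedAddCommGroup F] [NormedSpace ℝ F]
    [NormedAddCommGroup F'] [NormedSpace ℝ F'] {f : M → F} {f' : M → F'} {x : M}
    {L : Eucl d →L[ℝ] F} {L' : Eucl d →L[ℝ] F'} (h : HasMFDerivAt (𝓡 d) 𝓘(ℝ, F) f x L)
    (h' : HasMFDerivAt (𝓡 d) 𝓘(ℝ, F') f' x L') :
    HasMFDerivAt (𝓡 d) 𝓘(ℝ, F × F') (fun x => (f x, f' x)) x (L.prod L') := by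
  rw [hasMFDerivAt_vector_iff] at h h' ⊢
  exact ⟨h.1.prodMk h'.1, h.2.prodMk h'.2⟩

/-- The map `g = (G, s)` into the space of pairs (state, remaining time) is differentiable at `x`
and satisfies `(φ_s ∘ G)^* α = α` at `x` to first order. -/
def PreservesAt (X : ∀ x : M, TangentSpace (𝓡 d) x) (α : DiffForm d k M) (g : M → M × ℝ)
    (x : M) : Prop :=
  ∃ (A : Eucl d →L[ℝ] Eucl d) (b : Eucl d →L[ℝ] ℝ),
    HasMFDerivAt (𝓡 d) (𝓡 d) (fun z => (g z).1) x A ∧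
    HasMFDerivAt (𝓡 d) 𝓘(ℝ, ℝ) (fun z => (g z).2) x b ∧
    ∀ v : Fin k → Eucl d,
      formAt α (g x).1 (fun i => A (v i) + b (v i) • fieldAt X (g x).1) = formAt α x v

/-- A partial map of the space of pairs (state, remaining time), defined on the open set `W`, that
preserves the relation `PreservesAt`. -/
structure IsStep (X : ∀ x : M, TangentSpace (𝓡 d) x) (α : DiffForm d k M) (W : Set (M × ℝ))
    (T : M × ℝ → M × ℝ) : Prop where
  isOpen : IsOpen W
  preservesAt : ∀ (g : M → M × ℝ) (x : M), PreservesAt X α g x → g x ∈ W →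
    PreservesAt X α (T ∘ g) x

theorem PreservesAt.continuousAt {X : ∀ x : M, TangentSpace (𝓡 d) x} {α : DiffForm d k M}
    {g : M → M × ℝ} {x : M} (h : PreservesAt X α g x) : ContinuousAt g x := by
  obtain ⟨A, b, hA, hb, -⟩ := h
  exact hA.continuousAt.prodMk hb.continuousAt

theorem preservesAt_start (X : ∀ x : M, TangentSpace (𝓡 d) x) (α : DiffForm d k M) (t : ℝ)
    (x : M) : PreservesAt X α (fun z => (z, t)) x :=
  ⟨ContinuousLinearMap.id ℝ _, 0, hasMFDerivAt_id x, hasMFDerivAt_const t x, fun v => by simp⟩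

variable [IsManifold (𝓡 d) ∞ M]

theorem hasMFDerivAt_chart {x₀ x : M} (hx : x ∈ (extChartAt (𝓡 d) x₀).source) :
    HasMFDerivAt (𝓡 d) 𝓘(ℝ, Eucl d) (extChartAt (𝓡 d) x₀) x (chartDeriv x₀ x) :=
  (mdifferentiableAt_chart hx).hasMFDerivAt

theorem hasMFDerivAt_chart_symm {x₀ : M} {y : Eucl d} (hy : y ∈ (extChartAt (𝓡 d) x₀).target) :
    HasMFDerivAt 𝓘(ℝ, Eucl d) (𝓡 d) (extChartAt (𝓡 d) x₀).symm y (chartSymmDeriv x₀ y) :=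
  (mdifferentiableAt_chart_symm hy).hasMFDerivAt

/-- Integral curves, read in a chart. -/
theorem hasDerivWithinAt_chart_comp {X : ∀ x : M, TangentSpace (𝓡 d) x} {γ : ℝ → M} {s : Set ℝ}
    (hγ : IsMIntegralCurveOn (I := 𝓡 d) γ X s) {u : ℝ} (hu : u ∈ s) {x₀ : M}
    (hx : γ u ∈ (extChartAt (𝓡 d) x₀).source) :
    HasDerivWithinAt (extChartAt (𝓡 d) x₀ ∘ γ)
      (fieldInChart X x₀ (extChartAt (𝓡 d) x₀ (γ u))) s u := by
  have h := (hasMFDerivAt_chart hx).comp_hasMFDerivWithinAt u (hγ u hu)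
  rw [hasMFDerivWithinAt_iff_hasFDerivWithinAt] at h
  have h2 : HasDerivWithinAt (extChartAt (𝓡 d) x₀ ∘ γ) _ s u :=
    HasFDerivWithinAt.hasDerivWithinAt (F := Eucl d) h
  refine h2.congr_deriv ?_
  rw [fieldInChart_apply X hx]
  change chartDeriv x₀ (γ u) ((1 : ℝ) • fieldAt X (γ u)) = _
  rw [one_smul]

/-- Around every point there is a local flow, which preserves `α` when its Lie derivative
vanishes. -/
theorem exists_chart_localFlow {X : ∀ x : M, TangentSpace (𝓡 d) x}
    (hX : ContMDiff (𝓡 d) (𝓡 d).tangent ∞ (fun x => (⟨x, X x⟩ : TangentBundle (𝓡 d) M)))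
    {α : DiffForm d (k + 1) M} (hα : IsSmoothForm α) (hL : ∀ x, lieDerivative X α x = 0)
    (x₀ : M) :
    ∃ Ω V ε Φ D, Ω ⊆ (extChartAt (𝓡 d) x₀).target ∧ extChartAt (𝓡 d) x₀ x₀ ∈ V ∧
      IsLocalFlow (fieldInChart X x₀) Ω V ε Φ D ∧
      ∀ y ∈ V, ∀ σ ∈ Ioo (-ε) ε, ∀ v : Fin (k + 1) → Eucl d,
        formInChart α x₀ (Φ σ y) (fun i => D σ y (v i)) = formInChart α x₀ y v := by
  have hx₀ := mem_extChartAt_target (I := 𝓡 d) x₀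
  obtain ⟨Ω, hΩ, V, ε, Φ, D, hV, hF⟩ := exists_isLocalFlow
    ((contDiffAt_fieldInChart hX hx₀).of_le (by norm_cast))
    ((isOpen_extChartAt_target x₀).mem_nhds hx₀)
  exact ⟨Ω, V, ε, Φ, D, hΩ, hV, hF, fun y hy σ hσ v => hF.form_apply_D
    (fun y hy => (hα.contDiffAt (hΩ hy)).differentiableAt (by simp))
    (fun y hy => (contDiffAt_fieldInChart hX (hΩ hy)).differentiableAt (by simp))
    (fun y hy => lieDerivE_formInChart_eq_zero hX hα hL (hΩ hy)) hy hσ v⟩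

/-- The steps following the flow inside a flow box until the remaining time is `q`. -/
theorem exists_flowStep {X : ∀ x : M, TangentSpace (𝓡 d) x}
    (hX : ContMDiff (𝓡 d) (𝓡 d).tangent ∞ (fun x => (⟨x, X x⟩ : TangentBundle (𝓡 d) M)))
    {α : DiffForm d (k + 1) M} (hα : IsSmoothForm α) (hL : ∀ x, lieDerivative X α x = 0)
    (x₀ : M) :
    ∃ N ∈ 𝓝 x₀, ∃ (W : ℚ → Set (M × ℝ)) (T : ℚ → M × ℝ → M × ℝ),
      (∀ q, IsStep X α (W q) (T q)) ∧
      ∀ (γ : ℝ → M) (b : ℝ), IsMIntegralCurveOn (I := 𝓡 d) γ X (Icc 0 b) →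
        ∀ u₀ ∈ Icc 0 b, γ u₀ ∈ N → ∃ δ > 0, ∀ a ∈ Icc 0 b, ∀ a' ∈ Icc 0 b, a ≤ a' →
          a ∈ Ioo (u₀ - δ) (u₀ + δ) → a' ∈ Ioo (u₀ - δ) (u₀ + δ) →
          ∀ (s : ℝ) (q : ℚ), s - q = a' - a → (γ a, s) ∈ W q ∧ T q (γ a, s) = (γ a', (q : ℝ)) := by
  obtain ⟨Ω, V, ε, Φ, D, hΩ, hV, hF, hform⟩ := exists_chart_localFlow hX hα hL x₀
  set ψ := extChartAt (𝓡 d) x₀ with hψ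
  have hNopen : IsOpen (ψ.source ∩ ψ ⁻¹' V) :=
    (continuousOn_extChartAt x₀).isOpen_inter_preimage (isOpen_extChartAt_source x₀) hF.isOpen
  -- The step flows for the time `s - q` and leaves the constant remaining time `q`; restricting `q`
  -- to rationals keeps the family of steps countable.
  refine ⟨ψ.source ∩ ψ ⁻¹' V, hNopen.mem_nhds ⟨mem_extChartAt_source x₀, hV⟩,
    fun q => (ψ.source ∩ ψ ⁻¹' V) ×ˢ {s : ℝ | s - (q : ℝ) ∈ Ioo (-ε) ε},
    fun q z => (ψ.symm (Φ (z.2 - q) (ψ z.1)), q), fun q => ⟨?_, ?_⟩, ?_⟩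
  · exact hNopen.prod (isOpen_Ioo.preimage (by fun_prop))
  · rintro g x ⟨A, b, hA, hb, hg⟩ ⟨⟨hsrc, hVx⟩, hσ⟩
    set y := ψ (g x).1 with hy
    set σ := (g x).2 - q with hσdef
    have hyt : Φ σ y ∈ ψ.target := hΩ (hF.mem y hVx σ hσ)
    have h1 := (hasMFDerivAt_chart hsrc).comp x hA
    have h2 : HasMFDerivAt (𝓡 d) 𝓘(ℝ, ℝ) (fun z => (g z).2 - q) x b := by
      rw [hasMFDerivAt_vector_iff] at hb ⊢
      exact ⟨hb.1.sub continuousAt_const, hb.2.sub_const _⟩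
    have h3 := hasMFDerivAt_prodMk_vector h2 h1
    have h4 := HasMFDerivAt.comp (I' := 𝓘(ℝ, ℝ × Eucl d)) x
      (hF.hasFDerivAt y hVx σ hσ).hasMFDerivAt h3
    have h5 := HasMFDerivAt.comp (I' := 𝓘(ℝ, Eucl d)) x (hasMFDerivAt_chart_symm hyt) h4
    refine ⟨_, 0, h5, hasMFDerivAt_const _ x, fun v => ?_⟩
    rw [← hg v, ← formInChart_chart_apply α hsrc, ← hform y hVx σ hσ]
    change formAt α (ψ.symm (Φ σ y)) (fun i => chartSymmDeriv x₀ (Φ σ y)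
      (b (v i) • fieldInChart X x₀ (Φ σ y) + D σ y (chartDeriv x₀ (g x).1 (A (v i)))) +
      (0 : ℝ) • _) = _
    rw [formInChart_eq, ContinuousAlternatingMap.compContinuousLinearMap_apply]
    congr 1
    funext i
    simp only [comp_apply, zero_smul, add_zero]
    congr 1
    -- Since `D σ y (Y y) = Y (Φ σ y)`, the contribution of the varying flow time is also an image
    -- under `D`, and flow invariance of `α` applies to the whole vector `A v + b(v) X`.
    rw [map_add, map_smul, map_add, map_smul, ← fieldInChart_apply X hsrc, hF.D_apply y hVx σ hσ,
      add_comm]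
  · rintro γ b hγ u₀ hu₀ ⟨hu₀s, hu₀V⟩
    have h1 : ∀ᶠ u in 𝓝[Icc 0 b] u₀, γ u ∈ ψ.source ∩ ψ ⁻¹' V :=
      (hγ u₀ hu₀).1.eventually_mem (hNopen.mem_nhds ⟨hu₀s, hu₀V⟩)
    obtain ⟨η, hη, hηs⟩ := Metric.mem_nhdsWithin_iff.1 h1
    rw [Real.ball_eq_Ioo] at hηs
    -- Two times within `ε / 2` of `u₀` differ by less than `ε`, the lifetime of the local flow.
    have hδ : 0 < min η (ε / 2) := lt_min hη (by linarith [hF.pos])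
    refine ⟨min η (ε / 2), hδ, fun a ha a' ha' haa' hau hau' s q hs => ?_⟩
    have e1 := min_le_left η (ε / 2)
    have e2 := min_le_right η (ε / 2)
    have hin : ∀ u ∈ Icc a a', γ u ∈ ψ.source ∩ ψ ⁻¹' V := fun u hu => hηs
      ⟨⟨by linarith [hu.1, hau.1], by linarith [hu.2, hau'.2]⟩,
        ⟨ha.1.trans hu.1, hu.2.trans ha'.2⟩⟩
    have hsub : Icc a a' ⊆ Icc 0 b := Icc_subset_Icc ha.1 ha'.2
    have hlt : a' - a < ε := by linarith [hau.1, hau'.2]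
    have h2 := hF.eq_right (ψ ∘ γ) a a' haa' hlt (fun u hu => (hin u hu).2)
      (fun u hu => (hasDerivWithinAt_chart_comp hγ (hsub hu) (hin u hu).1).mono hsub)
    refine ⟨⟨hin a ⟨le_rfl, haa'⟩, ?_⟩, ?_⟩
    · change s - q ∈ Ioo (-ε) ε
      rw [hs]
      exact ⟨by linarith [hF.pos], hlt⟩
    · simp only [hs]
      simp only [comp_apply] at h2
      rw [h2, ψ.left_inv (hin a' ⟨haa', le_rfl⟩).1]

end ManifoldFlow

/-! ### Maps between manifolds in charts -/

section MapsInCharts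

open Set Filter Function

/-- The tangent space at `x` is identified with the model space by the preferred chart at `x`
itself. -/
theorem chartDeriv_self {d : ℕ} {M : Type*} [TopologicalSpace M] [ChartedSpace (Eucl d) M]
    [IsManifold (𝓡 d) ∞ M] (x : M) : chartDeriv x x = ContinuousLinearMap.id ℝ (Eucl d) := by
  have h : chartDeriv x x = fderivWithin ℝ (extChartAt (𝓡 d) x ∘ (extChartAt (𝓡 d) x).symm)
      (range (𝓡 d)) (extChartAt (𝓡 d) x x) :=
    (mdifferentiableAt_chart (mem_extChartAt_source x)).mfderiv
  have h' : extChartAt (𝓡 d) x ∘ (extChartAt (𝓡 d) x).symm =ᶠ[𝓝 (extChartAt (𝓡 d) x x)] id := by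
    filter_upwards [extChartAt_target_mem_nhds x] with y hy
    exact (extChartAt (𝓡 d) x).right_inv hy
  rw [h, ModelWithCorners.range_eq_univ, fderivWithin_univ, h'.fderiv_eq, fderiv_id]

variable {n d k : ℕ} {N : Type*} [TopologicalSpace N] [ChartedSpace (Eucl n) N]
  {M : Type*} [TopologicalSpace M] [ChartedSpace (Eucl d) M]

/-- The derivative of a map of manifolds, as a map of the model spaces. -/
noncomputable def mapDeriv (n d : ℕ) [ChartedSpace (Eucl n) N] [ChartedSpace (Eucl d) M]
    (f : N → M) (p : N) : Eucl n →L[ℝ] Eucl d :=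
  mfderiv (𝓡 n) (𝓡 d) f p

theorem hasMFDerivAt_mapDeriv {f : N → M} {p : N} (hf : ContMDiffAt (𝓡 n) (𝓡 d) ∞ f p) :
    HasMFDerivAt (𝓡 n) (𝓡 d) f p (mapDeriv n d f p) :=
  (hf.mdifferentiableAt (by simp)).hasMFDerivAt

omit [ChartedSpace (Eucl n) N] [TopologicalSpace N] in
theorem hasMFDerivAt_add_vector {F : Type*} [NormedAddCommGroup F] [NormedSpace ℝ F]
    {f f' : M → F} {x : M} {L L' : Eucl d →L[ℝ] F} (h : HasMFDerivAt (𝓡 d) 𝓘(ℝ, F) f x L)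
    (h' : HasMFDerivAt (𝓡 d) 𝓘(ℝ, F) f' x L') :
    HasMFDerivAt (𝓡 d) 𝓘(ℝ, F) (fun x => f x + f' x) x (L + L') := by
  rw [hasMFDerivAt_vector_iff] at h h' ⊢
  exact ⟨h.1.add h'.1, h.2.add h'.2⟩

variable [IsManifold (𝓡 n) ∞ N] [IsManifold (𝓡 d) ∞ M]

/-- The coordinate expression of a map of manifolds. -/
noncomputable def mapInChart (n d : ℕ) [ChartedSpace (Eucl n) N] [ChartedSpace (Eucl d) M]
    (f : N → M) (p₀ : N) (x₀ : M) : Eucl n → Eucl d :=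
  extChartAt (𝓡 d) x₀ ∘ f ∘ (extChartAt (𝓡 n) p₀).symm

theorem contDiffAt_mapInChart {f : N → M} {p₀ : N} {x₀ : M} {w : Eucl n}
    (hw : w ∈ (extChartAt (𝓡 n) p₀).target)
    (hf : ContMDiffAt (𝓡 n) (𝓡 d) ∞ f ((extChartAt (𝓡 n) p₀).symm w))
    (hw' : f ((extChartAt (𝓡 n) p₀).symm w) ∈ (extChartAt (𝓡 d) x₀).source) :
    ContDiffAt ℝ ∞ (mapInChart n d f p₀ x₀) w :=
  ((contMDiffAt_extChartAt' (by rwa [extChartAt_source] at hw')).comp w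
    (hf.comp w (contMDiffAt_chart_symm hw))).contDiffAt

theorem hasFDerivAt_mapInChart {f : N → M} {p₀ : N} {x₀ : M} {w : Eucl n}
    (hw : w ∈ (extChartAt (𝓡 n) p₀).target)
    (hf : ContMDiffAt (𝓡 n) (𝓡 d) ∞ f ((extChartAt (𝓡 n) p₀).symm w))
    (hw' : f ((extChartAt (𝓡 n) p₀).symm w) ∈ (extChartAt (𝓡 d) x₀).source) :
    HasFDerivAt (mapInChart n d f p₀ x₀) (chartDeriv x₀ (f ((extChartAt (𝓡 n) p₀).symm w)) ∘L
      mapDeriv n d f ((extChartAt (𝓡 n) p₀).symm w) ∘L chartSymmDeriv p₀ w) w := by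
  have h := (hasMFDerivAt_chart hw').comp w
    ((hasMFDerivAt_mapDeriv hf).comp w (hasMFDerivAt_chart_symm hw))
  rw [hasMFDerivAt_iff_hasFDerivAt] at h
  exact h

omit [IsManifold (𝓡 n) ∞ N] [IsManifold (𝓡 d) ∞ M] in
theorem fderiv_mapInChart_center {f : N → M} {p₀ : N}
    (hf : ContMDiffAt (𝓡 n) (𝓡 d) ∞ f p₀) :
    fderiv ℝ (mapInChart n d f p₀ (f p₀)) (extChartAt (𝓡 n) p₀ p₀) = mapDeriv n d f p₀ := by
  have h : mapDeriv n d f p₀ = fderivWithin ℝ (mapInChart n d f p₀ (f p₀)) (range (𝓡 n))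
      (extChartAt (𝓡 n) p₀ p₀) := (hf.mdifferentiableAt (by simp)).mfderiv
  rw [h, ModelWithCorners.range_eq_univ, fderivWithin_univ]

end MapsInCharts

/-! ### Steps through an impact -/

section ImpactStep

open Set Filter Function

variable {n k : ℕ} {N : Type*} [TopologicalSpace N] [ChartedSpace (Eucl n) N]
  [IsManifold (𝓡 n) ∞ N]
  {M : Type*} [TopologicalSpace M] [ChartedSpace (Eucl (n + 1)) M] [IsManifold (𝓡 (n + 1)) ∞ M]

/-- The step following the flow, inside a flow box, up to the hypersurface `ι` (forwards or
backwards in time) and then applying the reset map `r`. -/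
theorem exists_impactStep {X : ∀ x : M, TangentSpace (𝓡 (n + 1)) x}
    (hX : ContMDiff (𝓡 (n + 1)) (𝓡 (n + 1)).tangent ∞
      (fun x => (⟨x, X x⟩ : TangentBundle (𝓡 (n + 1)) M)))
    {α : DiffForm (n + 1) (k + 1) M} (hα : IsSmoothForm α) (hL : ∀ x, lieDerivative X α x = 0)
    {ι r : N → M} (hι : ContMDiff (𝓡 n) (𝓡 (n + 1)) ∞ ι) (hr : ContMDiff (𝓡 n) (𝓡 (n + 1)) ∞ r)
    (hinv : ∀ (p : N) (u : Fin (k + 1) → Eucl n) (s : Fin (k + 1) → ℝ),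
      formAt α (ι p) (fun i => mapDeriv n (n + 1) ι p (u i) + s i • fieldAt X (ι p)) =
        formAt α (r p) (fun i => mapDeriv n (n + 1) r p (u i) + s i • fieldAt X (r p)))
    (p₀ : N) (hc : IsCompl (LinearMap.range (mapDeriv n (n + 1) ι p₀ : Eucl n →ₗ[ℝ] Eucl (n + 1)))
      (Submodule.span ℝ {fieldAt X (ι p₀)})) :
    ∃ O ∈ 𝓝 p₀, ∃ (W : Set (M × ℝ)) (T : M × ℝ → M × ℝ), IsStep X α W T ∧
      ∀ (γ : ℝ → M) (τ : ℝ), 0 ≤ τ → IsMIntegralCurveOn (I := 𝓡 (n + 1)) γ X (Icc 0 τ) →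
        ∀ p ∈ O, γ τ = ι p → ∃ δ > 0, ∀ u ∈ Icc 0 τ, τ - u < δ → ∀ s : ℝ,
          (γ u, s) ∈ W ∧ T (γ u, s) = (r p, s - (τ - u)) := by
  obtain ⟨Ω, V, ε, Φ, D, hΩ, hV, hF, hform⟩ := exists_chart_localFlow hX hα hL (ι p₀)
  set ψ := extChartAt (𝓡 (n + 1)) (ι p₀) with hψ
  set ζ := extChartAt (𝓡 n) p₀ with hζ
  set j := mapInChart n (n + 1) ι p₀ (ι p₀) with hj
  have hw₀ : ζ p₀ ∈ ζ.target := mem_extChartAt_target p₀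
  have hζp₀ : ζ.symm (ζ p₀) = p₀ := extChartAt_to_inv p₀
  have hjp : ∀ p ∈ ζ.source, j (ζ p) = ψ (ι p) := fun p hp => by
    change ψ (ι (ζ.symm (ζ p))) = _
    rw [ζ.left_inv hp]
  have hO : {w | w ∈ ζ.target ∧ ι (ζ.symm w) ∈ ψ.source} ∈ 𝓝 (ζ p₀) := by
    refine ((isOpen_extChartAt_target p₀).mem_nhds hw₀ |> eventually_mem_set.2).and
      ((hι.continuous.continuousAt.comp (continuousAt_extChartAt_symm'' hw₀)).eventually_mem
        ((isOpen_extChartAt_source (ι p₀)).mem_nhds ?_))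
    change ι (ζ.symm (ζ p₀)) ∈ ψ.source
    rw [hζp₀]
    exact mem_extChartAt_source _
  have hsrc₀ : ι (ζ.symm (ζ p₀)) ∈ ψ.source := (mem_of_mem_nhds hO).2
  have hjV : j (ζ p₀) ∈ V := by
    rw [hjp p₀ (mem_extChartAt_source p₀)]
    exact hV
  have hc' : IsCompl (LinearMap.range (fderiv ℝ j (ζ p₀) : Eucl n →ₗ[ℝ] Eucl (n + 1)))
      (Submodule.span ℝ {fieldInChart X (ι p₀) (j (ζ p₀))}) := by
    rw [hj, fderiv_mapInChart_center hι.contMDiffAt, ← hj, hjp p₀ (mem_extChartAt_source p₀),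
      fieldInChart_apply X (mem_extChartAt_source (ι p₀)), chartDeriv_self]
    exact hc
  obtain ⟨Q, hQ0, hQ⟩ := hF.exists_flowBox
    ((contDiffAt_mapInChart hw₀ hι.contMDiffAt hsrc₀).of_le (by norm_cast)) hjV hO (by simp) hc'
  have hWopen : IsOpen (ψ.source ∩ ψ ⁻¹' Q.target) :=
    (continuousOn_extChartAt _).isOpen_inter_preimage (isOpen_extChartAt_source _) Q.open_target
  have hNopen : IsOpen (ψ.source ∩ ψ ⁻¹' V) :=
    (continuousOn_extChartAt _).isOpen_inter_preimage (isOpen_extChartAt_source _) hF.isOpen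
  have hPopen : IsOpen (ζ.source ∩ ζ ⁻¹' {w | ((0 : ℝ), w) ∈ Q.source}) :=
    (continuousOn_extChartAt p₀).isOpen_inter_preimage (isOpen_extChartAt_source p₀)
      (Q.open_source.preimage (by fun_prop))
  -- If the flow-box coordinates of a state are `(σ, w)`, the state is obtained from the
  -- hypersurface point `w` by flowing for time `σ`. Impact thus occurs after time `-σ`, and the
  -- remaining time there is `s + σ`.
  refine ⟨ζ.source ∩ ζ ⁻¹' {w | ((0 : ℝ), w) ∈ Q.source},
    hPopen.mem_nhds ⟨mem_extChartAt_source p₀, hQ0⟩, (ψ.source ∩ ψ ⁻¹' Q.target) ×ˢ univ,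
    fun z => (r (ζ.symm (Q.symm (ψ z.1)).2), z.2 + (Q.symm (ψ z.1)).1), ⟨?_, ?_⟩, ?_⟩
  · exact hWopen.prod isOpen_univ
  · rintro g x ⟨A, b, hA, hb, hg⟩ ⟨⟨hsrc, hVx⟩, -⟩
    set y := ψ (g x).1 with hy
    have hzs := Q.map_target hVx
    have hQz := Q.right_inv hVx
    set z := Q.symm y with hz
    obtain ⟨hσ, ⟨hwt, hws⟩, hjw, hQΦ, -, Q', hQ', hQd⟩ := hQ z hzs
    rw [hQz] at hQΦ hQd
    have hjd := hasFDerivAt_mapInChart hwt hι.contMDiffAt hws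
    rw [hjd.fderiv, ← hQΦ] at hQ'
    have h1 := (hasMFDerivAt_chart hsrc).comp x hA
    have h2 := HasMFDerivAt.comp (I' := 𝓘(ℝ, Eucl (n + 1))) x hQd.hasMFDerivAt h1
    have h3 : HasMFDerivAt (𝓡 (n + 1)) 𝓘(ℝ, Eucl n) (fun x => (Q.symm (ψ (g x).1)).2) x
        (ContinuousLinearMap.snd ℝ ℝ (Eucl n) ∘L (Q'.symm : Eucl (n + 1) →L[ℝ] ℝ × Eucl n) ∘L
          chartDeriv (ι p₀) (g x).1 ∘L A) :=
      HasMFDerivAt.comp (I' := 𝓘(ℝ, ℝ × Eucl n)) x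
        (ContinuousLinearMap.snd ℝ ℝ (Eucl n)).hasFDerivAt.hasMFDerivAt h2
    have h4 : HasMFDerivAt (𝓡 (n + 1)) 𝓘(ℝ, ℝ) (fun x => (Q.symm (ψ (g x).1)).1) x
        (ContinuousLinearMap.fst ℝ ℝ (Eucl n) ∘L (Q'.symm : Eucl (n + 1) →L[ℝ] ℝ × Eucl n) ∘L
          chartDeriv (ι p₀) (g x).1 ∘L A) :=
      HasMFDerivAt.comp (I' := 𝓘(ℝ, ℝ × Eucl n)) x
        (ContinuousLinearMap.fst ℝ ℝ (Eucl n)).hasFDerivAt.hasMFDerivAt h2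
    have h5 : HasMFDerivAt (𝓡 (n + 1)) 𝓘(ℝ, ℝ) (fun x => (g x).2 + (Q.symm (ψ (g x).1)).1) x
        (b + ContinuousLinearMap.fst ℝ ℝ (Eucl n) ∘L
          (Q'.symm : Eucl (n + 1) →L[ℝ] ℝ × Eucl n) ∘L chartDeriv (ι p₀) (g x).1 ∘L A) :=
      hasMFDerivAt_add_vector hb h4
    have h6 := (hasMFDerivAt_mapDeriv (hr.contMDiffAt (x := ζ.symm z.2))).comp x
      (HasMFDerivAt.comp (I' := 𝓘(ℝ, Eucl n)) x (hasMFDerivAt_chart_symm hwt) h3)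
    refine ⟨_, _, h6, h5, fun v => ?_⟩
    rw [← hg v, ← formInChart_chart_apply α hsrc]
    -- The flow-box components of the transported vectors: a multiple of the field, and a vector
    -- tangent to the hypersurface.
    set c : Fin (k + 1) → ℝ × Eucl n :=
      fun i => Q'.symm (chartDeriv (ι p₀) (g x).1 (A (v i))) with hcdef
    have hcv : ∀ i, chartDeriv (ι p₀) (g x).1 (A (v i)) = (c i).1 • fieldInChart X (ι p₀) y +
        D z.1 (j z.2) (chartDeriv (ι p₀) (ι (ζ.symm z.2)) (mapDeriv n (n + 1) ι (ζ.symm z.2)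
          (chartSymmDeriv p₀ z.2 (c i).2))) := fun i => by
      have : Q' (c i) = chartDeriv (ι p₀) (g x).1 (A (v i)) := Q'.apply_symm_apply _
      rw [← this, ← ContinuousLinearEquiv.coe_coe, hQ']
      rfl
    -- The new remaining time has derivative `b` plus the flow-box time component, which is the
    -- coefficient of `X` at the impact point both before and after the reset.
    have key := hinv (ζ.symm z.2) (fun i => chartSymmDeriv p₀ z.2 (c i).2)
      (fun i => b (v i) + (c i).1)
    refine key.symm.trans ?_
    rw [← formInChart_chart_apply α hws]
    change formInChart α (ι p₀) (j z.2) _ = _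
    rw [← hform (j z.2) hjw z.1 hσ, ← hQΦ]
    congr 1
    funext i
    rw [map_add, map_smul, map_add, map_smul, map_add, map_smul, ← fieldInChart_apply X hws,
      ← fieldInChart_apply X hsrc]
    change _ + _ • D z.1 (j z.2) (fieldInChart X (ι p₀) (j z.2)) = _
    rw [hF.D_apply _ hjw _ hσ, ← hQΦ, hcv, add_smul]
    abel
  · rintro γ τ hτ hγ p ⟨hps, hpQ⟩ hγτ
    have hpQ : ((0 : ℝ), ζ p) ∈ Q.source := hpQ
    obtain ⟨-, ⟨-, hws⟩, hjw, -⟩ := hQ _ hpQ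
    simp only [ζ.left_inv hps] at hws
    change j (ζ p) ∈ V at hjw
    rw [hjp p hps] at hjw
    have h1 : ∀ᶠ u in 𝓝[Icc 0 τ] τ, γ u ∈ ψ.source ∩ ψ ⁻¹' V :=
      (hγ τ ⟨hτ, le_rfl⟩).1.eventually_mem (hNopen.mem_nhds (by rw [hγτ]; exact ⟨hws, hjw⟩))
    have h2 : ∀ᶠ u in 𝓝[Icc 0 τ] τ, (u - τ, ζ p) ∈ Q.source := by
      have : Continuous fun u : ℝ => (u - τ, ζ p) := by fun_prop
      exact nhdsWithin_le_nhds (this.continuousAt.eventually_mem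
        (Q.open_source.mem_nhds (by simpa using hpQ)))
    obtain ⟨η, hη, hηs⟩ := Metric.mem_nhdsWithin_iff.1 (h1.and h2)
    rw [Real.ball_eq_Ioo] at hηs
    refine ⟨min η ε, lt_min hη hF.pos, fun u hu huδ s => ?_⟩
    have hin : ∀ a ∈ Icc u τ, (γ a ∈ ψ.source ∩ ψ ⁻¹' V) ∧ (a - τ, ζ p) ∈ Q.source := fun a ha =>
      hηs ⟨⟨by linarith [ha.1, min_le_left η ε], by linarith [ha.2, hη.lt]⟩,
        ⟨hu.1.trans ha.1, ha.2⟩⟩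
    have hsub : Icc u τ ⊆ Icc 0 τ := Icc_subset_Icc hu.1 le_rfl
    -- The trajectory is recovered by flowing backwards from its impact point, for the negative time
    -- `u - τ`.
    have h3 := hF.eq_left (ψ ∘ γ) u τ hu.2 (huδ.trans_le (min_le_right _ _))
      (fun a ha => (hin a ha).1.2)
      (fun a ha => (hasDerivWithinAt_chart_comp hγ (hsub ha) (hin a ha).1.1).mono hsub)
    simp only [comp_apply] at h3
    obtain ⟨⟨hus, -⟩, huQ⟩ := hin u ⟨le_rfl, hu.2⟩
    have h4 : Q (u - τ, ζ p) = ψ (γ u) := by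
      rw [(hQ _ huQ).2.2.2.1]
      change Φ (u - τ) (j (ζ p)) = _
      rw [hjp p hps, ← hγτ, h3]
    have h5 : Q.symm (ψ (γ u)) = (u - τ, ζ p) := by rw [← h4, Q.left_inv huQ]
    refine ⟨⟨⟨hus, ?_⟩, trivial⟩, ?_⟩
    · change ψ (γ u) ∈ Q.target
      rw [← h4]
      exact Q.map_source huQ
    · simp only [h5, ζ.left_inv hps]
      congr 1
      ring

end ImpactStep

/-! ### Rescaled volume forms and forms of top degree -/

section RescaledForm

open Set Filter Function ContinuousLinearMap

variable {d : ℕ} {M : Type*} [TopologicalSpace M] [ChartedSpace (Eucl d) M]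

theorem IsVolumeForm.smul {h : M → ℝ} [IsManifold (𝓡 d) ∞ M]
    (hh : ContMDiff (𝓡 d) 𝓘(ℝ, ℝ) ∞ h) (h0 : ∀ x, h x ≠ 0) {μ : DiffForm d d M}
    (hμ : IsVolumeForm μ) : IsVolumeForm (fun x => h x • μ x) := by
  refine ⟨fun x₀ => ?_, fun x => smul_ne_zero (h0 x) (hμ.ne_zero x)⟩
  have h1 : ContDiffOn ℝ ∞ (h ∘ (extChartAt (𝓡 d) x₀).symm) (extChartAt (𝓡 d) x₀).target :=
    (hh.comp_contMDiffOn (contMDiffOn_extChartAt_symm x₀)).contDiffOn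
  exact h1.smul (hμ.smooth x₀)

/-- Two top-degree forms on `ℝ × ℝⁿ` that agree on all `((1, 0), (0, u₁), …, (0, uₙ))` coincide. -/
theorem eq_of_apply_cons {n : ℕ} {A B : (ℝ × Eucl n) [⋀^Fin (n + 1)]→L[ℝ] ℝ}
    (h : ∀ u : Fin n → Eucl n, A (Fin.cons (1, 0) fun i => (0, u i)) =
      B (Fin.cons (1, 0) fun i => (0, u i))) : A = B := by
  set e : Fin n → Eucl n := fun i => EuclideanSpace.basisFun (Fin n) ℝ i with he
  have hspan : Submodule.span ℝ (range e) = ⊤ := by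
    have := (EuclideanSpace.basisFun (Fin n) ℝ).toBasis.span_eq
    rwa [OrthonormalBasis.coe_toBasis] at this
  set w : Fin (n + 1) → ℝ × Eucl n := Fin.cons (1, 0) (LinearMap.inr ℝ ℝ (Eucl n) ∘ e) with hw
  have htop : ⊤ ≤ Submodule.span ℝ (range w) := by
    rw [hw, Fin.range_cons, Submodule.span_insert, range_comp, ← Submodule.map_span, hspan]
    rintro ⟨a, u⟩ -
    refine Submodule.mem_sup.2 ⟨a • (1, 0), Submodule.smul_mem _ _
      (Submodule.mem_span_singleton_self _), (0, u), ⟨u, trivial, rfl⟩, by simp⟩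
  let b : Module.Basis (Fin (n + 1)) ℝ (ℝ × Eucl n) :=
    basisOfTopLeSpanOfCardEqFinrank w htop (by simp [add_comm])
  have hbw : (b : Fin (n + 1) → ℝ × Eucl n) = w :=
    coe_basisOfTopLeSpanOfCardEqFinrank w htop (by simp [add_comm])
  apply ContinuousAlternatingMap.toAlternatingMap_injective
  rw [A.toAlternatingMap.eq_smul_basis_det b, B.toAlternatingMap.eq_smul_basis_det b, hbw]
  exact congrArg (· • b.det) (h e)

end RescaledForm

/-! ### Consequences of the two cohomology equations -/

section HybridForm

open Set Filter Function ContinuousLinearMap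

variable {n : ℕ} {M : Type*} [TopologicalSpace M] [ChartedSpace (Eucl (n + 1)) M]
  [IsManifold (𝓡 (n + 1)) ∞ M]

omit [IsManifold (𝓡 (n + 1)) ∞ M] in
theorem lieDerivative_eq (X : ∀ x : M, TangentSpace (𝓡 (n + 1)) x) {k : ℕ}
    (α : DiffForm (n + 1) (k + 1) M) (x : M) :
    lieDerivative X α x = (lieDerivE (formInChart α x) (fieldInChart X x)
      (extChartAt (𝓡 (n + 1)) x x)).compContinuousLinearMap (chartDeriv x x) :=
  rfl

/-- Rescaling by the exponential of a function solving the cohomology equation. -/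
theorem lieDerivE_exp_smul_eq_zero {E : Type*} [NormedAddCommGroup E] [NormedSpace ℝ E] {k : ℕ}
    {a : E → E [⋀^Fin (k + 1)]→L[ℝ] ℝ} {Y : E → E} {f : E → ℝ} {y : E} {δ : ℝ}
    (ha : DifferentiableAt ℝ a y) (hY : DifferentiableAt ℝ Y y) (hf : DifferentiableAt ℝ f y)
    (hfY : fderiv ℝ f y (Y y) = -δ) (hδ : lieDerivE a Y y = δ • a y) (c : ℝ) :
    lieDerivE (fun z => (c * Real.exp (f z)) • a z) Y y = 0 := by
  have hE := hf.hasFDerivAt.exp.const_mul c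
  rw [lieDerivE_smul ha hY hE.differentiableAt, hE.fderiv, smul_apply, smul_apply, hfY, hδ]
  ext v
  simp only [ContinuousAlternatingMap.add_apply, ContinuousAlternatingMap.smul_apply, smul_eq_mul]
  change _ = (0 : ℝ)
  ring

theorem lieDerivE_formInChart_center (X : ∀ x : M, TangentSpace (𝓡 (n + 1)) x) {k : ℕ}
    (α : DiffForm (n + 1) (k + 1) M) (x : M) :
    lieDerivative X α x = lieDerivE (formInChart α x) (fieldInChart X x)
      (extChartAt (𝓡 (n + 1)) x x) := by
  rw [lieDerivative_eq, chartDeriv_self]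
  rfl

theorem formInChart_center {k : ℕ} (α : DiffForm (n + 1) k M) (x : M) :
    formInChart α x (extChartAt (𝓡 (n + 1)) x x) = formAt α x := by
  have h := formInChart_chart_comp α (mem_extChartAt_source (I := 𝓡 (n + 1)) x)
  rw [chartDeriv_self] at h
  exact h

theorem fieldInChart_center (X : ∀ x : M, TangentSpace (𝓡 (n + 1)) x) (x : M) :
    fieldInChart X x (extChartAt (𝓡 (n + 1)) x x) = fieldAt X x := by
  rw [fieldInChart_apply X (mem_extChartAt_source x), chartDeriv_self]
  rfl

/-- A volume form rescaled by a solution of the cohomology equation is invariant under the flow. -/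
theorem lieDerivative_exp_smul_eq_zero {X : ∀ x : M, TangentSpace (𝓡 (n + 1)) x}
    (hX : ContMDiff (𝓡 (n + 1)) (𝓡 (n + 1)).tangent ∞
      (fun x => (⟨x, X x⟩ : TangentBundle (𝓡 (n + 1)) M)))
    {μ : DiffForm (n + 1) (n + 1) M} (hμ : IsVolumeForm μ) {g : M → ℝ}
    (hg : ContMDiff (𝓡 (n + 1)) 𝓘(ℝ, ℝ) ∞ g)
    (hgX : ∀ x, mfderiv (𝓡 (n + 1)) 𝓘(ℝ, ℝ) g x (X x) = -divergence μ X x) (c : ℝ) (x : M) :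
    lieDerivative X (fun x => (c * Real.exp (g x)) • μ x) x = 0 := by
  have hy := mem_extChartAt_target (I := 𝓡 (n + 1)) x
  have hgd : MDifferentiableAt (𝓡 (n + 1)) 𝓘(ℝ, ℝ) g x := (hg x).mdifferentiableAt (by simp)
  obtain ⟨L, hL⟩ : ∃ L : Eucl (n + 1) →L[ℝ] ℝ, HasMFDerivAt (𝓡 (n + 1)) 𝓘(ℝ, ℝ) g x L :=
    ⟨_, hgd.hasMFDerivAt⟩
  have hLX : L (fieldAt X x) = -divergence μ X x := by
    have := hgX x
    rw [hL.mfderiv] at this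
    exact this
  have hgE := (hasMFDerivAt_vector_iff.1 hL).2
  rw [lieDerivE_formInChart_center]
  refine lieDerivE_exp_smul_eq_zero (f := g ∘ (extChartAt (𝓡 (n + 1)) x).symm)
    (δ := divergence μ X x) ((hμ.smooth.contDiffAt hy).differentiableAt (by simp))
    ((contDiffAt_fieldInChart hX hy).differentiableAt (by simp)) hgE.differentiableAt ?_ ?_ c
  · rw [hgE.fderiv, fieldInChart_center, hLX]
  · rw [formInChart_center]
    exact (lieDerivE_formInChart_center X μ x).symm.trans (divergence_spec hμ X x)

namespace HybridSystem

variable (H : HybridSystem n M)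

theorem contMDiff_incl : ContMDiff (𝓡 n) (𝓡 (n + 1)) ∞ H.incl :=
  H.isSmoothEmbedding_S.contMDiff

/-- A volume form rescaled by a solution of the cohomology equation is invariant under resets. -/
theorem exp_smul_reset (hH : H.IsSmooth) {μ : DiffForm (n + 1) (n + 1) M} (hμ : IsVolumeForm μ)
    {g : M → ℝ} (hg : H.SolvesHybridCohomology μ g) (c : ℝ) (p : H.S)
    (u : Fin (n + 1) → Eucl n) (s : Fin (n + 1) → ℝ) :
    formAt (fun x => (c * Real.exp (g x)) • μ x) (H.incl p)
        (fun i => mapDeriv n (n + 1) H.incl p (u i) + s i • fieldAt H.X (H.incl p)) =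
      formAt (fun x => (c * Real.exp (g x)) • μ x) (H.Δ p)
        (fun i => mapDeriv n (n + 1) H.Δ p (u i) + s i • fieldAt H.X (H.Δ p)) := by
  set J := H.hybridJacobian μ p with hJ
  -- The discrete cohomology equation in exponential form; positivity of the Jacobian removes the
  -- logarithm.
  have hexp : Real.exp (g (H.Δ p)) * J = Real.exp (g (H.incl p)) := by
    have h1 : g (H.incl p) = g (H.Δ p) + Real.log J := by
      have := hg.discrete_part p
      linarith
    rw [h1, Real.exp_add, Real.exp_log (hg.jacobian_pos p)]
  have hspec : ∀ w : Fin n → Eucl n,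
      formAt μ (H.Δ p) (Fin.cons (fieldAt H.X (H.Δ p)) fun i => mapDeriv n (n + 1) H.Δ p (w i)) =
      J * formAt μ (H.incl p) (Fin.cons (fieldAt H.X (H.incl p))
        fun i => mapDeriv n (n + 1) H.incl p (w i)) := fun w =>
    congrArg (fun f : Eucl n [⋀^Fin n]→L[ℝ] ℝ => f w) (H.hybridJacobian_spec hH hμ p)
  -- Both sides are values of top-degree forms on `ℝ × Eucl n`, pulled back along `(s, u) ↦ s X + dι
  -- u` and `(s, u) ↦ s X + dΔ u`. They need comparing only on frames starting with `(1, 0)`, where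
  -- they become the contracted forms of `hspec`.
  set A := (formAt (fun x => (c * Real.exp (g x)) • μ x) (H.incl p)).compContinuousLinearMap
    ((ContinuousLinearMap.toSpanSingleton ℝ (fieldAt H.X (H.incl p))).coprod
      (mapDeriv n (n + 1) H.incl p)) with hA
  set B := (formAt (fun x => (c * Real.exp (g x)) • μ x) (H.Δ p)).compContinuousLinearMap
    ((ContinuousLinearMap.toSpanSingleton ℝ (fieldAt H.X (H.Δ p))).coprod
      (mapDeriv n (n + 1) H.Δ p)) with hB
  have key : A = B := by
    refine eq_of_apply_cons fun w => ?_
    have hcons : ∀ (L : Eucl n →L[ℝ] Eucl (n + 1)) (v : Eucl (n + 1)),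
        ((ContinuousLinearMap.toSpanSingleton ℝ v).coprod L) ∘
          (Fin.cons (1, 0) (fun i => (0, w i)) : Fin (n + 1) → ℝ × Eucl n) =
        Fin.cons v fun i => L (w i) := fun L v => by
      funext i
      refine Fin.cases ?_ (fun i => ?_) i <;> simp
    rw [hA, hB, ContinuousAlternatingMap.compContinuousLinearMap_apply,
      ContinuousAlternatingMap.compContinuousLinearMap_apply, hcons, hcons]
    change (c * Real.exp (g (H.incl p))) * formAt μ (H.incl p) _ =
      (c * Real.exp (g (H.Δ p))) * formAt μ (H.Δ p) _
    rw [hspec, ← hexp]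
    ring
  have h := congrArg (fun f : (ℝ × Eucl n) [⋀^Fin (n + 1)]→L[ℝ] ℝ => f fun i => (s i, u i)) key
  simp only [hA, hB, ContinuousAlternatingMap.compContinuousLinearMap_apply, comp_def,
    ContinuousLinearMap.coprod_apply, ContinuousLinearMap.toSpanSingleton_apply] at h
  simpa only [add_comm] using h

end HybridSystem

end HybridForm

/-! ### Words of partial maps -/

section Words

open Set Filter Function

variable {Z J : Type*}

/-- The composition of the partial maps with the indices in the list. -/
def run (T : J → Z → Z) : List J → Z → Z
  | [], z => z
  | j :: w, z => run T w (T j z)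

/-- The domain of the composition of the partial maps `T j`, defined on `W j`, with the indices in
the list. -/
def runDomain (W : J → Set Z) (T : J → Z → Z) : List J → Set Z
  | [] => univ
  | j :: w => {z | z ∈ W j ∧ T j z ∈ runDomain W T w}

theorem exists_run_of_reflTransGen {W : J → Set Z} {T : J → Z → Z} {z z' : Z}
    (h : Relation.ReflTransGen (fun z z' => ∃ j, z ∈ W j ∧ T j z = z') z z') :
    ∃ w, z ∈ runDomain W T w ∧ run T w z = z' := by
  induction h using Relation.ReflTransGen.head_induction_on with
  | refl => exact ⟨[], trivial, rfl⟩
  | head h _ ih =>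
    obtain ⟨j, hj, rfl⟩ := h
    obtain ⟨w, hw, hr⟩ := ih
    exact ⟨j :: w, ⟨hj, hw⟩, hr⟩

variable {d k : ℕ} {M : Type*} [TopologicalSpace M] [ChartedSpace (Eucl d) M]

/-- `PreservesAt` forces continuity and the domains of the steps are open, so a whole neighbourhood
follows the word of `x`. Having the property nearby, and not only at `x`, makes the word continuous
at all neighbouring points. -/
theorem eventually_preservesAt_run {X : ∀ x : M, TangentSpace (𝓡 d) x} {α : DiffForm d k M}
    {W : J → Set (M × ℝ)} {T : J → M × ℝ → M × ℝ} (hT : ∀ j, IsStep X α (W j) (T j)) {x : M}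
    (w : List J) (g : M → M × ℝ) (hg : ∀ᶠ z in 𝓝 x, PreservesAt X α g z)
    (hx : g x ∈ runDomain W T w) :
    ∀ᶠ z in 𝓝 x, g z ∈ runDomain W T w ∧ PreservesAt X α (run T w ∘ g) z := by
  induction w generalizing g with
  | nil => exact hg.mono fun z hz => ⟨trivial, hz⟩
  | cons j w ih =>
    have h1 : ∀ᶠ z in 𝓝 x, g z ∈ W j :=
      hg.self_of_nhds.continuousAt.eventually_mem ((hT j).isOpen.mem_nhds hx.1)
    have h2 := ih (T j ∘ g) ((hg.and h1).mono fun z hz => (hT j).preservesAt g z hz.1 hz.2) hx.2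
    exact (h1.and h2).mono fun z hz => ⟨⟨hz.1, hz.2.1⟩, hz.2.2⟩

end Words

/-! ### Realising trajectories by chains of steps -/

section Coverage

open Set Filter Function Relation

variable {M : Type*}

/-- A family of short-time transitions along a curve is concatenated to transitions between
arbitrary times, through intermediate rational remaining times. -/
theorem transition_along_curve {R : M × ℝ → M × ℝ → Prop}
    (htrans : ∀ z₁ z₂ z₃, R z₁ z₂ → R z₂ z₃ → R z₁ z₃) {γ : ℝ → M} {b : ℝ}
    (h : ∀ u₀ ∈ Icc 0 b, ∃ δ > 0, ∀ a ∈ Icc 0 b, ∀ a' ∈ Icc 0 b, a ≤ a' →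
      a ∈ Ioo (u₀ - δ) (u₀ + δ) → a' ∈ Ioo (u₀ - δ) (u₀ + δ) →
      ∀ (s : ℝ) (q : ℚ), s - q = a' - a → R (γ a, s) (γ a', (q : ℝ)))
    (C : ℝ) {u : ℝ} (hu : u ∈ Icc 0 b) {q : ℚ} (hq : C - u = q) : R (γ 0, C) (γ u, (q : ℝ)) := by
  choose! δ hδ hstep using h
  -- A Lebesgue number makes the length of admissible transitions uniform along the compact time
  -- interval.
  obtain ⟨η, hη, hball⟩ := lebesgue_number_lemma_of_metric (isCompact_Icc (a := (0 : ℝ)) (b := b))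
    (c := fun i : Icc (0 : ℝ) b => Ioo (i - δ i : ℝ) (i + δ i)) (fun i => isOpen_Ioo)
    (fun x hx => mem_iUnion.2 ⟨⟨x, hx⟩, by
      have := hδ x hx
      constructor <;> simp only <;> linarith⟩)
  have hshort : ∀ a ∈ Icc 0 b, ∀ a' ∈ Icc 0 b, a ≤ a' → a' - a < η →
      ∀ (s : ℝ) (q : ℚ), s - q = a' - a → R (γ a, s) (γ a', (q : ℝ)) := by
    intro a ha a' ha' haa' hlt s q hs
    obtain ⟨i, hi⟩ := hball a ha
    rw [Real.ball_eq_Ioo] at hi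
    exact hstep i i.2 a ha a' ha' haa' (hi ⟨by linarith, by linarith⟩)
      (hi ⟨by linarith, by linarith⟩) s q hs
  have main : ∀ (m : ℕ) (u : ℝ), u ∈ Icc 0 b → u < (m + 1) * (η / 2) → ∀ q : ℚ, C - u = q →
      R (γ 0, C) (γ u, (q : ℝ)) := by
    intro m
    induction m with
    | zero =>
      intro u hu hlt q hq
      exact hshort 0 ⟨le_rfl, hu.1.trans hu.2⟩ u hu hu.1
        (by simp only [Nat.cast_zero] at hlt; linarith) C q (by linarith)
    | succ m ih =>
      intro u hu hlt q hq
      rcases lt_or_ge u η with h | h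
      · exact hshort 0 ⟨le_rfl, hu.1.trans hu.2⟩ u hu hu.1 (by linarith) C q (by linarith)
      -- The intermediate time `C - q'` lies between `u - η` and `u - η / 2`: close enough for one
      -- short transition, and far enough back for the induction hypothesis.
      · obtain ⟨q', hq'1, hq'2⟩ := exists_rat_btwn (show C - u + η / 2 < C - u + η by linarith)
        have hu' : C - q' ∈ Icc 0 b := ⟨by linarith, by linarith [hu.2]⟩
        refine htrans _ _ _ (ih (C - q') hu' ?_ q' (by ring))
          (hshort (C - q') hu' u hu (by linarith) (by linarith) q' q (by linarith))
        push_cast at hlt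
        linarith
  obtain ⟨m, hm⟩ := exists_nat_gt (u / (η / 2))
  refine main m u hu ?_ q hq
  have := (div_lt_iff₀ (by linarith : 0 < η / 2)).1 hm
  linarith

variable {n : ℕ} [TopologicalSpace M] [ChartedSpace (Eucl (n + 1)) M]
  [IsManifold (𝓡 (n + 1)) ∞ M]

/-- Transitions along the flow and through impacts realise the hybrid flow. -/
theorem HybridSystem.FlowsTo.transition {H : HybridSystem n M} {R : M × ℝ → M × ℝ → Prop}
    (htrans : ∀ z₁ z₂ z₃, R z₁ z₂ → R z₂ z₃ → R z₁ z₃)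
    (hflow : ∀ (γ : ℝ → M) (b : ℝ), IsMIntegralCurveOn (I := 𝓡 (n + 1)) γ H.X (Icc 0 b) →
      ∀ u₀ ∈ Icc 0 b, ∃ δ > 0, ∀ a ∈ Icc 0 b, ∀ a' ∈ Icc 0 b, a ≤ a' →
        a ∈ Ioo (u₀ - δ) (u₀ + δ) → a' ∈ Ioo (u₀ - δ) (u₀ + δ) →
        ∀ (s : ℝ) (q : ℚ), s - q = a' - a → R (γ a, s) (γ a', (q : ℝ)))
    (himpact : ∀ (γ : ℝ → M) (τ : ℝ), 0 ≤ τ →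
      IsMIntegralCurveOn (I := 𝓡 (n + 1)) γ H.X (Icc 0 τ) → ∀ p, γ τ = H.incl p →
        ∃ δ > 0, ∀ u ∈ Icc 0 τ, τ - u < δ → ∀ s : ℝ, R (γ u, s) (H.Δ p, s - (τ - u)))
    {t : ℝ} {x y : M} (h : H.FlowsTo t x y) : R (x, t) (y, 0) := by
  induction h with
  | @flow t x y γ ht hγ _ h_start h_end =>
    subst h_start h_end
    have := transition_along_curve htrans (hflow γ t hγ) t (u := t) ⟨ht, le_rfl⟩ (q := 0)
      (by simp)
    simpa using this
  | @impact τ t x y γ p hτ ht hγ _ h_start h_hit _ ih =>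
    subst h_start
    refine htrans _ _ _ ?_ ih
    obtain ⟨δ, hδ, hp⟩ := himpact γ τ hτ hγ p h_hit
    rcases lt_or_ge τ δ with hlt | hge
    · have := hp 0 ⟨le_rfl, hτ⟩ (by linarith) (τ + t)
      rwa [show τ + t - (τ - 0) = t by ring] at this
    -- The remaining time `t` at impact may be irrational. The flow steps therefore stop at a
    -- rational remaining time less than `δ` before the impact, and the impact step, which accepts
    -- any remaining time, covers the rest.
    · obtain ⟨q, hq1, hq2⟩ := exists_rat_btwn (show t < t + δ by linarith)
      have hu : τ + t - q ∈ Icc 0 τ := ⟨by linarith, by linarith⟩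
      have h1 := transition_along_curve htrans (hflow γ τ hγ) (τ + t) hu (q := q) (by ring)
      have h2 := hp _ hu (by linarith) q
      rw [show (q : ℝ) - (τ - (τ + t - q)) = t by ring] at h2
      exact htrans _ _ _ h1 h2

end Coverage

/-! ### Invariance on a dense set by Baire category -/

section Density

open Set Filter Function

variable {d k : ℕ} {M : Type*} [TopologicalSpace M] [ChartedSpace (Eucl d) M]

/-- A locally constant remaining time has derivative `b = 0`, so the correction along `X` disappears
and only `F^* α = α` is left. -/
theorem PreservesAt.pullback_eq {X : ∀ x : M, TangentSpace (𝓡 d) x} {α : DiffForm d k M}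
    {F : M → M} {g : M → M × ℝ} {a : M} {t : ℝ} (hg : PreservesAt X α g a)
    (h : ∀ᶠ z in 𝓝 a, g z = (F z, t)) : pullback F α a = α a := by
  obtain ⟨A, b, hA, hb, hv⟩ := hg
  have hga := h.self_of_nhds
  have hA' : HasMFDerivAt (𝓡 d) (𝓡 d) F a A :=
    hA.congr_of_eventuallyEq (h.mono fun z hz => (congrArg Prod.fst hz).symm)
  have hb' : HasMFDerivAt (𝓡 d) 𝓘(ℝ, ℝ) (fun _ : M => t) a b :=
    hb.congr_of_eventuallyEq (h.mono fun z hz => (congrArg Prod.snd hz).symm)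
  have hb0 : b = 0 := hasMFDerivAt_unique hb' (hasMFDerivAt_const t a)
  have h1 : (formAt α (F a)).compContinuousLinearMap (mapDeriv d d F a) = formAt α a := by
    have : mapDeriv d d F a = A := hA'.mfderiv
    rw [this]
    ext v
    have := hv v
    simp only [hga, hb0] at this
    rw [← this, ContinuousAlternatingMap.compContinuousLinearMap_apply]
    congr 1
    funext i
    simp
  exact h1

/-- A continuous map that is realised, at each point of an open set, by one of countably many
compositions of steps pulls `α` back to itself on a dense subset of that open set. -/
theorem exists_pullback_eq [T2Space M] [BaireSpace M] {J : Type*} [Countable J]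
    {X : ∀ x : M, TangentSpace (𝓡 d) x} {α : DiffForm d k M} {W : J → Set (M × ℝ)}
    {T : J → M × ℝ → M × ℝ} (hT : ∀ j, IsStep X α (W j) (T j)) {U : Set M} (hU : IsOpen U)
    {F : M → M} (hF : ContinuousOn F U) {t : ℝ}
    (hrun : ∀ x ∈ U, ∃ w, (x, t) ∈ runDomain W T w ∧ run T w (x, t) = (F x, 0))
    {O : Set M} (hO : IsOpen O) (hne : (O ∩ U).Nonempty) :
    ∃ a ∈ O ∩ U, pullback F α a = α a := by
  set A : List J → Set M :=
    fun w => {x | x ∈ U ∧ (x, t) ∈ runDomain W T w ∧ run T w (x, t) = (F x, 0)} with hA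
  -- The index `none` adds the complement of `U`, so that countably many closed sets cover all of
  -- `M`.
  set f : Option (List J) → Set M := fun i => i.elim Uᶜ fun w => closure (A w) with hf
  have hclosed : ∀ i, IsClosed (f i) := by
    rintro (_ | w)
    · exact hU.isClosed_compl
    · exact isClosed_closure
  have huniv : ⋃ i, f i = univ := by
    refine eq_univ_of_forall fun x => ?_
    by_cases hx : x ∈ U
    · obtain ⟨w, hw, hr⟩ := hrun x hx
      exact mem_iUnion.2 ⟨some w, subset_closure ⟨hx, hw, hr⟩⟩
    · exact mem_iUnion.2 ⟨none, hx⟩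
  obtain ⟨x, hx, hxi⟩ :=
    (dense_iUnion_interior_of_closed hclosed huniv).inter_open_nonempty _ (hO.inter hU) hne
  obtain ⟨i, hi⟩ := mem_iUnion.1 hxi
  obtain _ | w := i
  · exact absurd hx.2 (interior_subset hi)
  set V := O ∩ U ∩ _root_.interior (closure (A w)) with hV
  have hVo : IsOpen V := (hO.inter hU).inter isOpen_interior
  obtain ⟨a, haV, haU, hadom, hrun_a⟩ := mem_closure_iff.1 (interior_subset hi) V hVo ⟨hx, hi⟩
  refine ⟨a, haV.1, ?_⟩
  have hev := eventually_preservesAt_run hT w (fun z => (z, t))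
    (Eventually.of_forall fun z => preservesAt_start X α t z) hadom
  refine hev.self_of_nhds.2.pullback_eq (t := 0) ?_
  filter_upwards [hev, hVo.mem_nhds haV] with z hz hzV
  -- Near `a` the points where the word realises `F` are dense, and both maps are continuous, so
  -- they agree at `z`.
  refine tendsto_nhds_unique_of_frequently_eq hz.2.continuousAt.tendsto
    (((hF.continuousAt (hU.mem_nhds hzV.1.2)).prodMk continuousAt_const).tendsto) ?_
  exact (mem_closure_iff_frequently.1 (interior_subset hzV.2)).mono fun y hy => hy.2.2

end Density

/-! ### Extension by continuity and hybrid invariance -/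

section Continuity

open Set Filter Function

universe u

variable {n k : ℕ} {M : Type u} [TopologicalSpace M] [ChartedSpace (Eucl (n + 1)) M]
  [IsManifold (𝓡 (n + 1)) ∞ M]

/-- The equation `F^* α = α` is a closed condition. -/
theorem pullback_eq_of_frequently {α : DiffForm (n + 1) k M} (hα : IsSmoothForm α) {U : Set M}
    (hU : IsOpen U) {F : M → M} (hF : ContMDiffOn (𝓡 (n + 1)) (𝓡 (n + 1)) ∞ F U) {x : M}
    (hx : x ∈ U) (h : ∃ᶠ z in 𝓝 x, pullback F α z = α z) : pullback F α x = α x := by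
  set ψ := extChartAt (𝓡 (n + 1)) x with hψ
  have hxs : x ∈ ψ.source := mem_extChartAt_source x
  have hxt : ψ x ∈ ψ.target := mem_extChartAt_target x
  have hFU : ∀ z ∈ U, ContMDiffAt (𝓡 (n + 1)) (𝓡 (n + 1)) ∞ F z := fun z hz =>
    hF.contMDiffAt (hU.mem_nhds hz)
  have hxx : ψ.symm (ψ x) = x := ψ.left_inv hxs
  set f := mapInChart (n + 1) (n + 1) F x (F x) with hf
  have hfx : f (ψ x) = extChartAt (𝓡 (n + 1)) (F x) (F x) := by
    change extChartAt (𝓡 (n + 1)) (F x) (F (ψ.symm (ψ x))) = _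
    rw [hxx]
  have hfc : ContDiffAt ℝ ∞ f (ψ x) := contDiffAt_mapInChart hxt (by
    change ContMDiffAt (𝓡 (n + 1)) (𝓡 (n + 1)) ∞ F (ψ.symm (ψ x))
    rw [hxx]; exact hFU x hx) (by
    change F (ψ.symm (ψ x)) ∈ _
    rw [hxx]; exact mem_extChartAt_source (I := 𝓡 (n + 1)) _)
  have key : ∀ v : Fin k → Eucl (n + 1),
      formInChart α (F x) (f (ψ x)) (fun i => fderiv ℝ f (ψ x) (v i)) =
        formInChart α x (ψ x) v := by
    intro v
    have hψc : ContinuousAt ψ x := continuousAt_extChartAt x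
    have c1 : ContinuousAt (fun z => formInChart α (F x) (f (ψ z))) x := by
      refine ContinuousAt.comp (f := fun z => f (ψ z)) ?_ (hfc.continuousAt.comp hψc)
      rw [hfx]
      exact (hα.contDiffAt (mem_extChartAt_target _)).continuousAt
    have c2 : ContinuousAt (fun z => fderiv ℝ f (ψ z)) x :=
      (hfc.continuousAt_fderiv (by simp)).comp hψc
    have c3 : ContinuousAt (fun z => fun i => fderiv ℝ f (ψ z) (v i)) x :=
      continuousAt_pi.2 fun i => c2.clm_apply continuousAt_const
    have c4 : ContinuousAt (fun z => formInChart α x (ψ z)) x :=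
      ((hα.contDiffAt hxt).continuousAt).comp hψc
    -- In charts fixed at `x` and `F x`, both sides are continuous in the base point and agree at
    -- points arbitrarily close to `x`.
    refine tendsto_nhds_unique_of_frequently_eq (c1.eval c3).tendsto
      (c4.eval continuousAt_const).tendsto ?_
    have hev : ∀ᶠ z in 𝓝 x, z ∈ ψ.source ∧ z ∈ U ∧ F z ∈ (extChartAt (𝓡 (n + 1)) (F x)).source :=
      ((isOpen_extChartAt_source (I := 𝓡 (n + 1)) x).mem_nhds hxs |> eventually_mem_set.2).and
        ((eventually_mem_set.2 (hU.mem_nhds hx)).and ((hFU x hx).continuousAt.eventually_mem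
          ((isOpen_extChartAt_source (F x)).mem_nhds (mem_extChartAt_source _))))
    refine (h.and_eventually hev).mono fun z ⟨hz, hzs, hzU, hzF⟩ => ?_
    have hzz : ψ.symm (ψ z) = z := ψ.left_inv hzs
    have hd := hasFDerivAt_mapInChart (f := F) (p₀ := x) (x₀ := F x) (w := ψ z)
      (ψ.map_source hzs) (by
        change ContMDiffAt (𝓡 (n + 1)) (𝓡 (n + 1)) ∞ F (ψ.symm (ψ z))
        rw [hzz]; exact hFU z hzU)
      (by change F (ψ.symm (ψ z)) ∈ _; rw [hzz]; exact hzF)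
    change formInChart α (F x) (extChartAt (𝓡 (n + 1)) (F x) (F (ψ.symm (ψ z))))
      (fun i => fderiv ℝ f (ψ z) (v i)) = _
    rw [← hψ, hzz] at hd
    rw [hd.fderiv, hzz, formInChart_eq α x, ← hψ, hzz]
    have h1 : (formAt α (F z)).compContinuousLinearMap (mapDeriv (n + 1) (n + 1) F z) =
      formAt α z := hz
    rw [← h1]
    exact formInChart_chart_apply α hzF _
  rw [hfx, fderiv_mapInChart_center (hFU x hx), formInChart_center, formInChart_center] at key
  have h1 : (formAt α (F x)).compContinuousLinearMap (mapDeriv (n + 1) (n + 1) F x) =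
      formAt α x := by
    ext v
    exact key v
  exact h1

namespace HybridSystem

variable (H : HybridSystem n M)

/-- Countably many steps suffice to realise the hybrid flow. -/
theorem exists_steps [SecondCountableTopology M] (hH : H.IsSmooth)
    {α : DiffForm (n + 1) (k + 1) M} (hα : IsSmoothForm α) (hL : ∀ x, lieDerivative H.X α x = 0)
    (hreset : ∀ (p : H.S) (u : Fin (k + 1) → Eucl n) (s : Fin (k + 1) → ℝ),
      formAt α (H.incl p)
          (fun i => mapDeriv n (n + 1) H.incl p (u i) + s i • fieldAt H.X (H.incl p)) =
        formAt α (H.Δ p)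
          (fun i => mapDeriv n (n + 1) H.Δ p (u i) + s i • fieldAt H.X (H.Δ p))) :
    ∃ (J : Type u) (_ : Countable J) (W : J → Set (M × ℝ)) (T : J → M × ℝ → M × ℝ),
      (∀ j, IsStep H.X α (W j) (T j)) ∧ ∀ (t : ℝ) (x y : M), H.FlowsTo t x y →
        ∃ w, (x, t) ∈ runDomain W T w ∧ run T w (x, t) = (y, 0) := by
  choose N hN Wf Tf hTf hcov using fun x₀ => exists_flowStep H.contMDiff_X hα hL x₀
  choose O hO Wi Ti hTi hcov' using fun p₀ => exists_impactStep H.contMDiff_X hα hL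
    H.contMDiff_incl H.contMDiff_Δ hreset p₀ (hH.transverse p₀)
  -- Second countability of `M`, and hence of `S`, leaves countably many flow boxes of each kind.
  obtain ⟨A, hA, hAN⟩ := TopologicalSpace.countable_cover_nhds hN
  obtain ⟨B, hB, hBO⟩ := TopologicalSpace.countable_cover_nhds hO
  have := hA.to_subtype
  have := hB.to_subtype
  refine ⟨(A × ℚ) ⊕ B, inferInstance, Sum.elim (fun i => Wf i.1 i.2) fun p => Wi p,
    Sum.elim (fun i => Tf i.1 i.2) fun p => Ti p, ?_, fun t x y h => ?_⟩
  · rintro (i | p)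
    · exact hTf i.1 i.2
    · exact hTi p
  · refine exists_run_of_reflTransGen (h.transition (fun _ _ _ h h' => h.trans h') ?_ ?_)
    · intro γ b hγ u₀ hu₀
      obtain ⟨x₀, hx₀, hx₀N⟩ := mem_iUnion₂.1 (hAN.ge (mem_univ (γ u₀)))
      obtain ⟨δ, hδ, hstep⟩ := hcov x₀ γ b hγ u₀ hu₀ hx₀N
      exact ⟨δ, hδ, fun a ha a' ha' haa' h1 h2 s q hs =>
        .single ⟨Sum.inl (⟨x₀, hx₀⟩, q), hstep a ha a' ha' haa' h1 h2 s q hs⟩⟩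
    · intro γ τ hτ hγ p hp
      obtain ⟨p₀, hp₀, hpO⟩ := mem_iUnion₂.1 (hBO.ge (mem_univ p))
      obtain ⟨δ, hδ, hstep⟩ := hcov' p₀ γ τ hτ hγ p hpO hp
      exact ⟨δ, hδ, fun u hu hlt s => .single ⟨Sum.inr ⟨p₀, hp₀⟩, hstep u hu hlt s⟩⟩

/-- A smooth form that is invariant under the flow and under resets is hybrid-invariant. -/
theorem isHybridInvariant [T2Space M] [SecondCountableTopology M] (hH : H.IsSmooth)
    {α : DiffForm (n + 1) (k + 1) M} (hα : IsSmoothForm α) (hL : ∀ x, lieDerivative H.X α x = 0)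
    (hreset : ∀ (p : H.S) (u : Fin (k + 1) → Eucl n) (s : Fin (k + 1) → ℝ),
      formAt α (H.incl p)
          (fun i => mapDeriv n (n + 1) H.incl p (u i) + s i • fieldAt H.X (H.incl p)) =
        formAt α (H.Δ p)
          (fun i => mapDeriv n (n + 1) H.Δ p (u i) + s i • fieldAt H.X (H.Δ p))) :
    H.IsHybridInvariant α := by
  intro t _ U hU _ F hF hFs x hx
  -- Local compactness, with the Hausdorff property, makes `M` a Baire space.
  have := ChartedSpace.locallyCompactSpace (Eucl (n + 1)) M
  obtain ⟨J, _, W, T, hT, hrun⟩ := H.exists_steps hH hα hL hreset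
  refine pullback_eq_of_frequently hα hU hFs hx ?_
  refine mem_closure_iff_frequently.1 (mem_closure_iff.2 fun O hO hxO => ?_)
  obtain ⟨a, ha, h⟩ := exists_pullback_eq hT hU hFs.continuousOn
    (fun x hx => hrun t x (F x) (hF x hx)) hO ⟨x, hxO, hx⟩
  exact ⟨a, ha.1, h⟩

end HybridSystem

end Continuity

end HybridDyn

theorem mainTheorem10 {n : ℕ} {M : Type*} [TopologicalSpace M] [T2Space M]
    [SecondCountableTopology M] [ChartedSpace (HybridDyn.Eucl (n + 1)) M]
    [IsManifold (𝓡 (n + 1)) ∞ M]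
    (H : HybridDyn.HybridSystem n M) (hH : H.IsSmooth)
    (μ : HybridDyn.DiffForm (n + 1) (n + 1) M) (hμ : HybridDyn.IsVolumeForm μ)
    (g : M → ℝ) (hg : H.SolvesHybridCohomology μ g) (c : ℝ) (hc : c ≠ 0) :
    HybridDyn.IsVolumeForm (fun x => (c * Real.exp (g x)) • μ x) ∧
      H.IsHybridInvariant (fun x => (c * Real.exp (g x)) • μ x) := by
  have hh : ContMDiff (𝓡 (n + 1)) 𝓘(ℝ, ℝ) ∞ fun x => c * Real.exp (g x) :=
    (contDiff_const.mul Real.contDiff_exp).comp_contMDiff hg.smooth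
  have hvol := hμ.smul hh fun x => mul_ne_zero hc (Real.exp_ne_zero _)
  exact ⟨hvol, H.isHybridInvariant hH hvol.smooth
    (HybridDyn.lieDerivative_exp_smul_eq_zero H.contMDiff_X hμ hg.smooth hg.continuous_part c)
    (H.exp_smul_reset hH hμ hg c)⟩
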